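/- Let $N\ge 1$ agents have continuously differentiable $f_i:\mathbb R^K\to\mathbb R$ with average $f=\frac1N\sum_i f_i>\underline f$ on $\mathbb R^K$. For every compact $X\subset\mathbb R^K$ let $\nabla f$ and $\nabla f_i$ be Lipschitz on $X$ with constants $L(X)>0$ and $L_i(X)\ge 1$, monotone in $X$, and put $\hat L(X)=\max_i L_i(X)\ge L(X)$. Let $\mathbf W$ be a symmetric mixing matrix of an undirected graph on the agents: $W_{ij}>0$ if $i,j$ are neighbours, $W_{ij}=0$ if $i\ne j$ are not, $W_{ii}\ge0$, $\mathrm{Null}(I-\mathbf W)=\mathrm{span}\{\mathbf 1\}$, $-I\preceq\mathbf W\preceq I$, and $\eta:=\|\mathbf W-\frac1N\mathbf 1\mathbf 1^T\|<1$ (spectral norm). Let $\gamma,\xi>0$, $(1+\gamma)\eta^2<1$, $(1+\xi)\eta^2<1$. A bar denotes the average over agents, and norms of stacked vectors are Euclidean. MAGENTA with accuracy parameter $\delta>0$ and radius increment $d>0$ starts from $\mathbf x_i(0)$, $\mathbf y_i(0)=\nabla f_i(\mathbf x_i(0))$, puts $z=\bar{\mathbf x}(0)$, and runs stages $t=0,1,2,\dots$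 with $X(t)=B(td,z)$ (closed ball of radius $v^t=td$), $\hat L(t)=\hat L(X(t))$, $$\alpha(t)=\min\Big\{\tfrac1{8N}\Big(\tfrac{\hat L(t)}{2N}+\tfrac1\gamma+\tfrac54\Big)^{-1},\ \tfrac{N(1-(1+\gamma)\eta^2)(1-(1+\xi)\eta^2)}{64(1+1/\xi)\hat L(t)^2},\ 1\Big\},\qquad R(t)=\lceil 1/(\delta\alpha(t))\rceil .$$ Stage $t$ starts from the final iterate of the previous stage and performs $R(t)$ inner iterations $$\tilde{\mathbf x}_i^{r+1}=\arg\min_{u\in X(t)}\langle\mathbf y_i^r,u-\mathbf x_i^r\rangle+\tfrac1{2\alpha(t)}\|u-\mathbf x_i^r\|^2,\quad \mathbf x_i^{r+1}=\sum_jW_{ij}\big(\mathbf x_j^r+\tfrac12(\tilde{\mathbf x}_j^{r+1}-\mathbf x_j^r)\big),\quad \mathbf y_i^{r+1}=\sum_jW_{ij}\mathbf y_j^r+\nabla f_i(\mathbf x_i^{r+1})-\nabla f_i(\mathbf x_i^r),$$ each of which costs every agent one communication round and two local gradient evaluations (plus one evaluation at the start). Let $$\text{avg-gap}(t)=\frac1{R(t)}\sum_{r=0}^{R(t)-1}\big(\|\mathbf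 y^r\|^2+\|\mathbf x^r-\mathbf 1\bar{\mathbf x}^r\|^2+\|\mathbf y^r-\mathbf 1\bar{\mathbf y}^r\|^2\big)$$ for the iterates of stage $t$, let $\mathrm{gr}(v)=\max\{L(B(v,z)),\hat L(B(v,z))^2\}$, and let $\Delta=\Delta(d,\delta)=P(\mathbf w^0;1)-\underline f$, where $$P(\mathbf w^0;1)=f(\bar{\mathbf x})+\|\mathbf x-\mathbf 1\bar{\mathbf x}\|^2+\frac{1-(1+\gamma)\eta^2}{32(1+1/\xi)\hat L(1)^2}\|\mathbf y-\mathbf 1\bar{\mathbf y}\|^2$$ at the beginning of stage $1$. Below, $d>0$, $0<\epsilon<2(1-(1+\gamma)\eta^2)$ and $\mathbf x_i(0)\in B(d,z)$ for all $i$. The cost of $T$ stages means the number of communication rounds, and likewise the number of local gradient evaluations per agent, made by the end of stage $T$ (stage $0$ included). (1) There is a constant $C_0$ depending only on $N,\eta,\gamma,\xi$ such that, with $\delta=\epsilon$ and $T^*=\lceil 128\Delta/(\epsilon d^2)\rceil$, some stage $t\in[1,T^*]$ has $\text{avg-gap}(t)\le C_0\Delta\,\epsilon$, and the cost of $T^*$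 stages is at most $C_0\,T^*\,\frac1\epsilon\,\mathrm{gr}(d\,T^*)$. (2) There are constants $\kappa,C,C_1>0$, independent of $d$ and $\epsilon$ (they may depend on the problem, $\mathbf W$, $\gamma$, $\xi$ and $\mathbf x(0)$), such that, with $\delta=\kappa\epsilon$ and $T=\lceil C/(\epsilon d^2)\rceil$, some stage $t\in[1,T]$ has $\text{avg-gap}(t)\le\epsilon$, and the cost of $T$ stages is at most $C_1\,T\,\frac1\epsilon\,\mathrm{gr}(d\,T)$. (3) Suppose in addition that every $f_i$ is a polynomial of total degree at most $Q$, $Q\ge2$, and that each $L_i(X)$ is the smallest Lipschitz constant $\ge 1$ of $\nabla f_i$ on $X$. Then for $d=1/\sqrt\epsilon$ the quantities $T^*\frac1\epsilon\mathrm{gr}(dT^*)$ of (1) and $T\frac1\epsilon\mathrm{gr}(dT)$ of (2), and the costs in (1) and (2), are $O(1/\epsilon^{Q-1})$ (and the gap in (1) is $O(\epsilon)$), with constants independent of $\epsilon$. -/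

import Mathlib

open scoped BigOperators

noncomputable section

namespace Magenta

/-- The space `ℝ^K` with the Euclidean norm. -/
abbrev Vec (K : ℕ) : Type := EuclideanSpace ℝ (Fin K)

/-- The average `x̄ = (1/N) ∑ᵢ xᵢ` of the blocks of a stacked vector. -/
def mean {N K : ℕ} (x : Fin N → Vec K) : Vec K := (1 / (N : ℝ)) • ∑ i, x i

/-- The squared `ℓ²` norm of a stacked vector. -/
def sqNorm {N K : ℕ} (x : Fin N → Vec K) : ℝ := ∑ i, ‖x i‖ ^ 2

/-- The squared consensus error `‖x - 𝟏 x̄‖²`. -/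
def consErr {N K : ℕ} (x : Fin N → Vec K) : ℝ := sqNorm fun i => x i - mean x

/-- The average objective `f(u) = (1/N) ∑ᵢ fᵢ(u)`. -/
def avgFun {N K : ℕ} (f : Fin N → Vec K → ℝ) (u : Vec K) : ℝ := (1 / (N : ℝ)) * ∑ i, f i u

/-- `g` is Lipschitz on `X` with constant `ℓ`. -/
def LipOn {K : ℕ} (g : Vec K → Vec K) (ℓ : ℝ) (X : Set (Vec K)) : Prop :=
  ∀ y ∈ X, ∀ z ∈ X, ‖g y - g z‖ ≤ ℓ * ‖y - z‖

/-- `L̂(X) = maxᵢ Lᵢ(X)`. -/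
def Lhat {N K : ℕ} (Li : Fin N → Set (Vec K) → ℝ) (X : Set (Vec K)) : ℝ := ⨆ i, Li i X

/-- The growth function `gr(v) = max {L(B(v,z)), L̂(B(v,z))²}` of the Lipschitz constants on
the balls with centre `z`. -/
def gr {N K : ℕ} (L : Set (Vec K) → ℝ) (Li : Fin N → Set (Vec K) → ℝ) (z : Vec K) (v : ℝ) : ℝ :=
  max (L (Metric.closedBall z v)) (Lhat Li (Metric.closedBall z v) ^ 2)

/-- Assumptions on the problem: continuously differentiable local functions whose gradients, as
well as that of the average, are Lipschitz on each compact set `X` with constants `Lᵢ(X) ≥ 1`,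
`0 < L(X) ≤ L̂(X)`, monotone in `X`; the average function is bounded below by `flow`. -/
structure ProblemAssumption {N K : ℕ} (f : Fin N → Vec K → ℝ) (L : Set (Vec K) → ℝ)
    (Li : Fin N → Set (Vec K) → ℝ) (flow : ℝ) : Prop where
  contDiff : ∀ i, ContDiff ℝ 1 (f i)
  lip_avg : ∀ X, IsCompact X → LipOn (gradient (avgFun f)) (L X) X
  lip_local : ∀ i X, IsCompact X → LipOn (gradient (f i)) (Li i X) X
  L_pos : ∀ X, IsCompact X → 0 < L X
  one_le_Li : ∀ i X, IsCompact X → 1 ≤ Li i X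
  L_mono : ∀ X Y, IsCompact X → IsCompact Y → X ⊆ Y → L X ≤ L Y
  Li_mono : ∀ i X Y, IsCompact X → IsCompact Y → X ⊆ Y → Li i X ≤ Li i Y
  L_le_Lhat : ∀ X, IsCompact X → L X ≤ Lhat Li X
  lower : ∀ u, flow < avgFun f u

/-- The constants `Lᵢ(X)` are the smallest Lipschitz constants `≥ 1` of `∇ fᵢ` on compact sets. -/
def SharpConstants {N K : ℕ} (f : Fin N → Vec K → ℝ) (Li : Fin N → Set (Vec K) → ℝ) : Prop :=
  ∀ i X, IsCompact X → ∀ ℓ : ℝ, 1 ≤ ℓ → LipOn (gradient (f i)) ℓ X → Li i X ≤ ℓ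

/-- The contraction factor `η = ‖W - (1/N) 𝟏𝟏ᵀ‖` (spectral norm); for a mixing matrix this is
the second largest modulus of an eigenvalue of `W`. -/
def eta {N : ℕ} (W : Matrix (Fin N) (Fin N) ℝ) : ℝ :=
  ‖Matrix.toEuclideanCLM (n := Fin N) (𝕜 := ℝ) (W - Matrix.of fun _ _ => 1 / (N : ℝ))‖

/-- Assumptions on the mixing matrix of the undirected graph `G`. -/
structure MixingMatrix {N : ℕ} (G : SimpleGraph (Fin N)) (W : Matrix (Fin N) (Fin N) ℝ) :
    Prop where
  symm : W.IsSymm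
  ker : LinearMap.ker (Matrix.toLin' (1 - W)) = Submodule.span ℝ {fun _ => (1 : ℝ)}
  le_one : (1 - W).PosSemidef
  neg_one_le : (1 + W).PosSemidef
  pos : ∀ i j, G.Adj i j → 0 < W i j
  zero : ∀ i j, i ≠ j → ¬ G.Adj i j → W i j = 0
  diag : ∀ i, 0 ≤ W i i
  eta_lt_one : eta W < 1

/-- A state of the network: the local variables `xᵢ`, the gradient trackers `yᵢ`, the number of
communication rounds performed so far and the number of local gradient evaluations made so far
by each agent. -/
structure State (N K : ℕ) where
  x : Fin N → Vec K
  y : Fin N → Vec K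
  comm : ℕ
  grads : ℕ

/-- The objective `⟪y, u - x⟫ + ‖u - x‖² / (2α)` of the local projection step. -/
def localModel {K : ℕ} (α : ℝ) (x y u : Vec K) : ℝ :=
  inner ℝ y (u - x) + 1 / (2 * α) * ‖u - x‖ ^ 2

/-- The minimizer `x̃` of the local model over `X`. -/
def localArgmin {K : ℕ} (X : Set (Vec K)) (α : ℝ) (x y : Vec K) : Vec K :=
  Classical.epsilon fun u => u ∈ X ∧ IsMinOn (localModel α x y) X u

theorem localArgmin_spec {K : ℕ} {X : Set (Vec K)} (hX : IsCompact X) (hne : X.Nonempty)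
    (α : ℝ) (x y : Vec K) :
    localArgmin X α x y ∈ X ∧ IsMinOn (localModel α x y) X (localArgmin X α x y) := by
  have hc : ContinuousOn (localModel α x y) X := by
    unfold localModel
    fun_prop
  exact Classical.epsilon_spec (hX.exists_isMinOn hne hc)

/-- One inner iteration with feasible set `X` and stepsizes `α`, `β`: one communication round, and
the two local gradients `∇ fᵢ(xᵢ⁺)`, `∇ fᵢ(xᵢ)`. -/
def innerStep {N K : ℕ} (f : Fin N → Vec K → ℝ) (W : Matrix (Fin N) (Fin N) ℝ)
    (X : Set (Vec K)) (α β : ℝ) (s : State N K) : State N K :=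
  let v : Fin N → Vec K := fun i => localArgmin X α (s.x i) (s.y i) - s.x i
  let x' : Fin N → Vec K := fun i => ∑ j, W i j • (s.x j + β • v j)
  { x := x'
    y := fun i => ∑ j, W i j • s.y j + gradient (f i) (x' i) - gradient (f i) (s.x i)
    comm := s.comm + 1
    grads := s.grads + 2 }

/-- The data that determine a run of MAGENTA: local functions, mixing matrix, local Lipschitz
constants, parameters `γ`, `ξ`, radii `v^t`, accuracy parameter and initial point `x(0)`. -/
structure Input (N K : ℕ) where
  f : Fin N → Vec K → ℝ
  W : Matrix (Fin N) (Fin N) ℝ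
  Li : Fin N → Set (Vec K) → ℝ
  γ : ℝ
  ξ : ℝ
  v : ℕ → ℝ
  acc : ℝ
  x0 : Fin N → Vec K

namespace Input

variable {N K : ℕ} (A : Input N K)

/-- The feasible set `X(t) = B(v^t, z)` with `z = x̄(0)`. -/
def X (t : ℕ) : Set (Vec K) := Metric.closedBall (mean A.x0) (A.v t)

/-- `L̂(t) = L̂(X(t))`. -/
def Lh (t : ℕ) : ℝ := Lhat A.Li (A.X t)

/-- `1 - (1 + γ) η²`. -/
def a : ℝ := 1 - (1 + A.γ) * eta A.W ^ 2

/-- `1 - (1 + ξ) η²`. -/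
def b : ℝ := 1 - (1 + A.ξ) * eta A.W ^ 2

/-- The stepsize `α(t)`. -/
def α (t : ℕ) : ℝ :=
  min (min (1 / (8 * (N : ℝ)) * (1 / (A.Lh t / (2 * (N : ℝ)) + (1 / A.γ + 5 / 4))))
    ((N : ℝ) * A.a * A.b / (64 * (1 + 1 / A.ξ) * A.Lh t ^ 2))) 1

/-- The number `R(t) = 1 / (acc · α(t))`, rounded up, of inner iterations in stage `t`. -/
def R (t : ℕ) : ℕ := ⌈1 / (A.acc * A.α t)⌉₊

/-- The result of `r` inner iterations of stage `t`, started at `s`; here `β = 1/2`. -/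
def inner (t r : ℕ) (s : State N K) : State N K :=
  (innerStep A.f A.W (A.X t) (A.α t) (1 / 2))^[r] s

/-- The state at the beginning of stage `t`, that is, after the stages `0, …, t - 1`. -/
def state : ℕ → State N K
  | 0 => { x := A.x0, y := fun i => gradient (A.f i) (A.x0 i), comm := 0, grads := 1 }
  | t + 1 => A.inner t (A.R t) (state t)

/-- The `r`-th iterate of stage `t`. -/
def iter (t r : ℕ) : State N K := A.inner t r (A.state t)

/-- The averaged unconstrained stationarity gap of stage `t`. -/
def avgGap (t : ℕ) : ℝ :=
  1 / (A.R t : ℝ) * ∑ r ∈ Finset.range (A.R t),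
    (sqNorm (A.iter t r).y + consErr (A.iter t r).x + consErr (A.iter t r).y)

/-- The potential function `P(w; t)`. -/
def P (s : State N K) (t : ℕ) : ℝ :=
  avgFun A.f (mean s.x) + consErr s.x
    + A.a / (32 * (1 + 1 / A.ξ) * A.Lh t ^ 2) * consErr s.y

/-- Within the stages `1, …, T` the averaged gap of some stage is at most `tol`, and by the end of
stage `T` (with stage `0` included) each agent has taken part in at most `B` communication rounds
and has made at most `B` local gradient evaluations. -/
def ReachesWithin (T : ℕ) (tol B : ℝ) : Prop :=
  (∃ t, 1 ≤ t ∧ t ≤ T ∧ A.avgGap t ≤ tol) ∧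
    ((A.state (T + 1)).comm : ℝ) ≤ B ∧ ((A.state (T + 1)).grads : ℝ) ≤ B

end Input

/-- The data of a problem instance that do not depend on the radii and the accuracy. -/
structure Instance (N K : ℕ) where
  f : Fin N → Vec K → ℝ
  L : Set (Vec K) → ℝ
  Li : Fin N → Set (Vec K) → ℝ
  flow : ℝ
  W : Matrix (Fin N) (Fin N) ℝ
  x0 : Fin N → Vec K

namespace Instance

variable {N K : ℕ} (I : Instance N K)

/-- The run with radii `v^t = t d`, parameters `γ`, `ξ` and accuracy parameter `acc`. -/
def run (γ ξ d acc : ℝ) : Input N K :=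
  { f := I.f, W := I.W, Li := I.Li, γ := γ, ξ := ξ, v := fun t => (t : ℝ) * d,
    acc := acc, x0 := I.x0 }

/-- `P(w⁰; 1) - flow`, where `w⁰` is the state at the beginning of stage `1`. -/
def Δ (γ ξ d acc : ℝ) : ℝ :=
  (I.run γ ξ d acc).P ((I.run γ ξ d acc).state 1) 1 - I.flow

/-- The bound `T · (1/ε) · gr(d T)`. -/
def bound (d ε : ℝ) (T : ℕ) : ℝ :=
  (T : ℝ) * (1 / ε) * gr I.L I.Li (mean I.x0) (d * (T : ℝ))

/-- `d` and `ε` are positive, `ε < 2 (1 - (1 + γ) η²)`, and the initial point lies in `X(1)`. -/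
def Admissible (γ d ε : ℝ) : Prop :=
  0 < d ∧ 0 < ε ∧ ε < 2 * (1 - (1 + γ) * eta I.W ^ 2) ∧
    ∀ i, I.x0 i ∈ Metric.closedBall (mean I.x0) d

/-- Every `fᵢ` is a polynomial of degree at most `Q`. -/
def IsPoly (Q : ℕ) : Prop :=
  ∀ i, ∃ p : MvPolynomial (Fin K) ℝ, p.totalDegree ≤ Q ∧
    ∀ u : Vec K, I.f i u = MvPolynomial.eval (fun k => u k) p

end Instance

/-- The number of stages `⌈M / (ε d²)⌉`. -/
def stages (M d ε : ℝ) : ℕ := ⌈M / (ε * d ^ 2)⌉₊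

end Magenta

end

/-! A stage in which the potential `P` falls only a little is a stage in which no agent feels the
ball constraint, and for unconstrained steps the fall of `P` controls the gap.

In stages t ≥ 1 every inner iteration lowers `P` by at least `drop`, a weighted sum of ‖x̃ - x‖² and
the two consensus errors: the descent lemma at the mean yields the gain, mixing contracts the errors
by η², and the stepsize is small enough to absorb the cross terms (`potential_arith`,
`P_iter_succ_add_drop_le`). Enlarging the ball only lowers the weight of the tracking error, so the
drops of all stages sum to at most Δ, and one of T stages drops by at most Δ/T
(`exists_stageDrop_le`).

At the start of stage t the mean lies in X(t-1), hence at depth at least d inside X(t). If the stage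
drops by at most acc·d²/128, then the drift of the mean, the consensus error and the step add up to
less than d; so x̃ is interior and x̃ - x = -αy (`step_eq_of_stageDrop_le`). Now ‖y‖² = ‖x̃ -
x‖²/α², and averaging over R ≥ 1/(acc·α) iterations cancels the stepsize
(`avgGap_le_of_stageDrop_le`). The cost bound follows from 1/α = O(L̂²).

For (2), Δ is bounded by initial data alone, since stage 0 pulls the agents towards z without moving
their mean (`P_state_one_le`); κ then absorbs the constant. For (3), gradients of polynomials of
degree Q have Lipschitz constants O(ρ^(Q-2)) on balls of radius ρ; when εd² = 1 the number of stages
is bounded and the radius dT is O(ε^(-1/2)), so gr/ε = O(ε^(-(Q-1))). -/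

noncomputable section

namespace Magenta

variable {N K : ℕ}

/-! ### Stacked vectors -/

/-- The stacked vector `(W ⊗ I) u`. -/
def mix (W : Matrix (Fin N) (Fin N) ℝ) (u : Fin N → Vec K) : Fin N → Vec K :=
  fun i => ∑ j, W i j • u j

theorem sqNorm_nonneg (u : Fin N → Vec K) : 0 ≤ sqNorm u :=
  Finset.sum_nonneg fun _ _ => by positivity

theorem consErr_nonneg (u : Fin N → Vec K) : 0 ≤ consErr u := sqNorm_nonneg _

theorem norm_sq_le_sqNorm (u : Fin N → Vec K) (i : Fin N) : ‖u i‖ ^ 2 ≤ sqNorm u :=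
  Finset.single_le_sum (f := fun i => ‖u i‖ ^ 2) (fun _ _ => by positivity) (Finset.mem_univ i)

theorem mean_add (u w : Fin N → Vec K) : mean (fun i => u i + w i) = mean u + mean w := by
  simp [mean, Finset.sum_add_distrib, smul_add]

theorem mean_sub (u w : Fin N → Vec K) : mean (fun i => u i - w i) = mean u - mean w := by
  simp [mean, Finset.sum_sub_distrib, smul_sub]

theorem mean_smul (c : ℝ) (u : Fin N → Vec K) : mean (fun i => c • u i) = c • mean u := by
  simp [mean, ← Finset.smul_sum, smul_comm c]

theorem mean_const (hN : 0 < N) (p : Vec K) : mean (fun _ : Fin N => p) = p := by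
  have : (N : ℝ) ≠ 0 := by positivity
  simp [mean, ← Nat.cast_smul_eq_nsmul ℝ, smul_smul, this]

theorem sum_eq_smul_mean (hN : 0 < N) (u : Fin N → Vec K) : ∑ i, u i = (N : ℝ) • mean u := by
  have : (N : ℝ) ≠ 0 := by positivity
  simp [mean, smul_smul, this]

theorem norm_add_sq_le_young {E : Type*} [SeminormedAddCommGroup E] {γ : ℝ} (hγ : 0 < γ)
    (u w : E) : ‖u + w‖ ^ 2 ≤ (1 + γ) * ‖u‖ ^ 2 + (1 + 1 / γ) * ‖w‖ ^ 2 := by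
  have h1 : ‖u + w‖ ^ 2 ≤ (‖u‖ + ‖w‖) ^ 2 := by gcongr; exact norm_add_le u w
  have h2 : (1 + γ) * ‖u‖ ^ 2 + (1 + 1 / γ) * ‖w‖ ^ 2 - (‖u‖ + ‖w‖) ^ 2
      = (γ * ‖u‖ - ‖w‖) ^ 2 / γ := by field_simp; ring
  have h3 : 0 ≤ (γ * ‖u‖ - ‖w‖) ^ 2 / γ := by positivity
  linarith

theorem sqNorm_add_le {γ : ℝ} (hγ : 0 < γ) (u w : Fin N → Vec K) :
    sqNorm (fun i => u i + w i) ≤ (1 + γ) * sqNorm u + (1 + 1 / γ) * sqNorm w := by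
  unfold sqNorm
  rw [Finset.mul_sum, Finset.mul_sum, ← Finset.sum_add_distrib]
  exact Finset.sum_le_sum fun i _ => norm_add_sq_le_young hγ _ _

theorem sqNorm_sub_le (u w : Fin N → Vec K) :
    sqNorm (fun i => u i - w i) ≤ 2 * sqNorm u + 2 * sqNorm w := by
  have h := sqNorm_add_le one_pos u (fun i => - w i)
  have h2 : sqNorm (fun i => - w i) = sqNorm w := by simp [sqNorm]
  rw [h2] at h
  simp only [← sub_eq_add_neg] at h
  linarith

theorem sqNorm_smul (c : ℝ) (u : Fin N → Vec K) :
    sqNorm (fun i => c • u i) = c ^ 2 * sqNorm u := by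
  simp [sqNorm, norm_smul, mul_pow, Finset.mul_sum]

theorem consErr_smul (c : ℝ) (u : Fin N → Vec K) :
    consErr (fun i => c • u i) = c ^ 2 * consErr u := by
  unfold consErr
  rw [mean_smul, ← sqNorm_smul]
  simp [smul_sub]

theorem consErr_add_le {γ : ℝ} (hγ : 0 < γ) (u w : Fin N → Vec K) :
    consErr (fun i => u i + w i) ≤ (1 + γ) * consErr u + (1 + 1 / γ) * consErr w := by
  unfold consErr
  rw [mean_add]
  simp_rw [add_sub_add_comm]
  exact sqNorm_add_le hγ (fun i => u i - mean u) (fun i => w i - mean w)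

theorem consErr_sub_const (hN : 0 < N) (u : Fin N → Vec K) (p : Vec K) :
    consErr (fun i => u i - p) = consErr u := by
  unfold consErr
  rw [mean_sub, mean_const hN]
  simp

/-- Pythagoras: u - 𝟏ū is orthogonal to the consensus subspace. -/
theorem sqNorm_eq_consErr_add (hN : 0 < N) (u : Fin N → Vec K) :
    sqNorm u = consErr u + N * ‖mean u‖ ^ 2 := by
  have h1 : ∀ i, ‖u i - mean u‖ ^ 2 = ‖u i‖ ^ 2 - 2 * inner ℝ (u i) (mean u) + ‖mean u‖ ^ 2 :=
    fun i => norm_sub_sq_real _ _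
  unfold consErr sqNorm
  simp_rw [h1]
  rw [Finset.sum_add_distrib, Finset.sum_sub_distrib, ← Finset.mul_sum, ← sum_inner,
    sum_eq_smul_mean hN, inner_smul_left, real_inner_self_eq_norm_sq]
  simp
  ring

theorem consErr_le_sqNorm (hN : 0 < N) (u : Fin N → Vec K) : consErr u ≤ sqNorm u := by
  rw [sqNorm_eq_consErr_add hN]
  have : 0 ≤ (N : ℝ) * ‖mean u‖ ^ 2 := by positivity
  linarith

theorem norm_mean_sq_le (hN : 0 < N) (u : Fin N → Vec K) : N * ‖mean u‖ ^ 2 ≤ sqNorm u := by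
  rw [sqNorm_eq_consErr_add hN]
  linarith [consErr_nonneg u]

theorem norm_sub_mean_sq_le (u : Fin N → Vec K) (i : Fin N) : ‖u i - mean u‖ ^ 2 ≤ consErr u :=
  norm_sq_le_sqNorm (fun i => u i - mean u) i

/-- Cauchy-Schwarz for stacked vectors. -/
theorem sum_inner_le_sqrt (u w : Fin N → Vec K) :
    ∑ i, inner ℝ (u i) (w i) ≤ √(sqNorm u) * √(sqNorm w) := by
  calc ∑ i, inner ℝ (u i) (w i) ≤ ∑ i, ‖u i‖ * ‖w i‖ :=
        Finset.sum_le_sum fun i _ => real_inner_le_norm _ _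
    _ ≤ _ := Real.sum_mul_le_sqrt_mul_sqrt _ _ _

theorem mean_mem {X : Set (Vec K)} (hX : Convex ℝ X) (hN : 0 < N) {u : Fin N → Vec K}
    (hu : ∀ i, u i ∈ X) : mean u ∈ X := by
  have hN' : (N : ℝ) ≠ 0 := by positivity
  unfold mean
  rw [Finset.smul_sum]
  exact hX.sum_mem (fun _ _ => by positivity) (by simp [hN']) fun i _ => hu i

/-! ### Mixing matrices -/

namespace MixingMatrix

variable {G : SimpleGraph (Fin N)} {W : Matrix (Fin N) (Fin N) ℝ} (h : MixingMatrix G W)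

include h

theorem nonneg (i j : Fin N) : 0 ≤ W i j := by
  by_cases hij : i = j
  · rw [hij]; exact h.diag j
  · by_cases hG : G.Adj i j
    · exact (h.pos i j hG).le
    · rw [h.zero i j hij hG]

theorem sum_row (i : Fin N) : ∑ j, W i j = 1 := by
  have h1 : (fun _ => (1 : ℝ)) ∈ LinearMap.ker (Matrix.toLin' (1 - W)) := by
    rw [h.ker]; exact Submodule.mem_span_singleton_self _
  rw [LinearMap.mem_ker, Matrix.toLin'_apply] at h1
  have h2 := congrFun h1 i
  rw [Matrix.sub_mulVec, Matrix.one_mulVec] at h2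
  simp [Matrix.mulVec, dotProduct] at h2
  linarith

theorem sum_col (j : Fin N) : ∑ i, W i j = 1 := by
  rw [← h.sum_row j]
  exact Finset.sum_congr rfl fun i _ => h.symm.apply j i

theorem mean_mix (u : Fin N → Vec K) : mean (mix W u) = mean u := by
  unfold mean mix
  rw [Finset.sum_comm]
  simp_rw [← Finset.sum_smul, h.sum_col, one_smul]

theorem mix_const (p : Vec K) : mix W (fun _ => p) = fun _ => p := by
  funext i
  simp [mix, ← Finset.sum_smul, h.sum_row]

theorem mix_mem {X : Set (Vec K)} (hX : Convex ℝ X) {u : Fin N → Vec K}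
    (hu : ∀ i, u i ∈ X) (i : Fin N) : mix W u i ∈ X :=
  hX.sum_mem (fun j _ => h.nonneg i j) (h.sum_row i) fun j _ => hu j

/-- Jensen for ‖·‖² in each row, then the column sums: double stochasticity suffices. -/
theorem sqNorm_mix_le (u : Fin N → Vec K) : sqNorm (mix W u) ≤ sqNorm u := by
  have hc : ConvexOn ℝ Set.univ fun p : Vec K => ‖p‖ ^ 2 :=
    (convexOn_norm convex_univ).pow (fun _ _ => norm_nonneg _) 2
  calc sqNorm (mix W u) ≤ ∑ i, ∑ j, W i j * ‖u j‖ ^ 2 :=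
        Finset.sum_le_sum fun i _ => 
          hc.map_sum_le (t := Finset.univ) (w := W i) (p := u)
            (fun j _ => h.nonneg i j) (h.sum_row i) (fun _ _ => Set.mem_univ _)
    _ = sqNorm u := by
        rw [Finset.sum_comm]
        simp_rw [← Finset.sum_mul, h.sum_col, one_mul]
        rfl

end MixingMatrix

theorem mix_sub (W : Matrix (Fin N) (Fin N) ℝ) (u w : Fin N → Vec K) :
    mix W (fun i => u i - w i) = fun i => mix W u i - mix W w i := by
  funext i
  simp [mix, smul_sub, Finset.sum_sub_distrib]

theorem mix_add (W : Matrix (Fin N) (Fin N) ℝ) (u w : Fin N → Vec K) :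
    mix W (fun i => u i + w i) = fun i => mix W u i + mix W w i := by
  funext i
  simp [mix, smul_add, Finset.sum_add_distrib]

/-- A ⊗ I acts on each of the K coordinates separately as A, so the operator norm of A applies
coordinate by coordinate. -/
theorem sqNorm_mix_le_norm (A : Matrix (Fin N) (Fin N) ℝ) (u : Fin N → Vec K) :
    sqNorm (mix A u) ≤ ‖Matrix.toEuclideanCLM (n := Fin N) (𝕜 := ℝ) A‖ ^ 2 * sqNorm u := by
  have hk : ∀ k : Fin K, ∑ i, (mix A u i k) ^ 2
      ≤ ‖Matrix.toEuclideanCLM (n := Fin N) (𝕜 := ℝ) A‖ ^ 2 * ∑ i, (u i k) ^ 2 := by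
    intro k
    have h1 := (Matrix.toEuclideanCLM (n := Fin N) (𝕜 := ℝ) A).le_opNorm
      (WithLp.toLp 2 fun i => u i k)
    have h2 := pow_le_pow_left₀ (norm_nonneg _) h1 2
    rw [mul_pow, EuclideanSpace.norm_sq_eq, EuclideanSpace.norm_sq_eq] at h2
    simpa [mix, Matrix.toEuclideanCLM_toLp, Matrix.mulVec, dotProduct] using h2
  have e : ∀ w : Fin N → Vec K, sqNorm w = ∑ k, ∑ i, (w i k) ^ 2 := by
    intro w
    unfold sqNorm
    rw [Finset.sum_comm]
    exact Finset.sum_congr rfl fun i _ => by simp [EuclideanSpace.norm_sq_eq]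
  rw [e, e, Finset.mul_sum]
  exact Finset.sum_le_sum fun k _ => hk k

/-- Since u - 𝟏ū has mean zero and W fixes consensus vectors, (W - 𝟏𝟏ᵀ/N)(u - 𝟏ū) = Wu - 𝟏ū. -/
theorem MixingMatrix.consErr_mix_le {G : SimpleGraph (Fin N)} {W : Matrix (Fin N) (Fin N) ℝ}
    (h : MixingMatrix G W) (hN : 0 < N) (u : Fin N → Vec K) :
    consErr (mix W u) ≤ eta W ^ 2 * consErr u := by
  have hJ : ∀ w : Fin N → Vec K, mix (W - Matrix.of fun _ _ => 1 / (N : ℝ)) w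
      = fun i => mix W w i - mean w := by
    intro w
    funext i
    simp [mix, mean, sub_smul, Finset.sum_sub_distrib, Finset.smul_sum]
  have h1 := sqNorm_mix_le_norm (W - Matrix.of fun _ _ => 1 / (N : ℝ)) (fun i => u i - mean u)
  rw [hJ, mean_sub, mean_const hN, mix_sub, h.mix_const] at h1
  unfold consErr
  rw [h.mean_mix]
  simp only [sub_self, sub_zero] at h1
  exact h1

/-! ### The local projection step -/

/-- Completing the square: minimizing the model means projecting the gradient point x - αy. -/
theorem localModel_eq {α : ℝ} (hα : 0 < α) (x y u : Vec K) :
    localModel α x y u = 1 / (2 * α) * ‖u - (x - α • y)‖ ^ 2 - α / 2 * ‖y‖ ^ 2 := by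
  have h1 : u - (x - α • y) = (u - x) + α • y := by abel
  rw [localModel, h1, norm_add_sq_real, inner_smul_right, norm_smul, real_inner_comm,
    Real.norm_of_nonneg hα.le]
  field_simp
  ring

/-- Compare the minimizer p with (1 - s)p + sx ∈ X, divide by s, and let s → 0. -/
theorem inner_le_of_isMinOn {X : Set (Vec K)} (hX : Convex ℝ X) {α : ℝ} (hα : 0 < α)
    {x y p : Vec K} (hx : x ∈ X) (hp : p ∈ X) (hmin : IsMinOn (localModel α x y) X p) :
    inner ℝ y (p - x) ≤ -(1 / α) * ‖p - x‖ ^ 2 := by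
  have key : ∀ s : ℝ, 0 < s → s < 1 →
      inner ℝ y (p - x) ≤ (-2 + s) * (1 / (2 * α) * ‖p - x‖ ^ 2) := by
    intro s hs0 hs1
    have hmem : (1 - s) • p + s • x ∈ X := hX hp hx (by linarith) hs0.le (by ring)
    have h1 : localModel α x y p ≤ localModel α x y ((1 - s) • p + s • x) := hmin hmem
    have h2 : (1 - s) • p + s • x - x = (1 - s) • (p - x) := by module
    rw [localModel, localModel, h2, inner_smul_right, norm_smul, mul_pow, Real.norm_eq_abs,
      sq_abs] at h1
    have h3 : s * inner ℝ y (p - x) ≤ s * ((-2 + s) * (1 / (2 * α) * ‖p - x‖ ^ 2)) := by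
      linarith
    exact le_of_mul_le_mul_left h3 hs0
  have e : -(1 / α) * ‖p - x‖ ^ 2 = -2 * (1 / (2 * α) * ‖p - x‖ ^ 2) := by
    field_simp
  rw [e]
  set B := 1 / (2 * α) * ‖p - x‖ ^ 2 with hB
  have hB0 : 0 ≤ B := by positivity
  refine le_of_forall_pos_le_add fun ε hε => ?_
  -- This s makes sB ≤ ε; the denominator is B + 1 because B may vanish.
  have hs : 0 < min (1 / 2) (ε / (B + 1)) := lt_min (by norm_num) (by positivity)
  have h4 := key _ hs (lt_of_le_of_lt (min_le_left _ _) (by norm_num))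
  have h5 : min (1 / 2) (ε / (B + 1)) * B ≤ ε / (B + 1) * (B + 1) :=
    mul_le_mul (min_le_right _ _) (by linarith) hB0 (by positivity)
  rw [div_mul_cancel₀ _ (by positivity)] at h5
  linarith

/-- From an interior point one can move a little towards the unconstrained minimizer q, which
shrinks the distance to q by 1 - s; at a minimizer this is possible only if p = q. -/
theorem sub_eq_of_isMinOn_of_mem_interior {X : Set (Vec K)} {α : ℝ} (hα : 0 < α)
    {x y p : Vec K} (hp : p ∈ interior X) (hmin : IsMinOn (localModel α x y) X p) :
    p - x = -(α • y) := by
  set q := x - α • y with hq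
  suffices h : p = q by rw [h, hq]; abel
  have hcont : Filter.Tendsto (fun s : ℝ => p + s • (q - p)) (nhdsWithin 0 (Set.Ioi 0))
      (nhds p) := by
    have : Continuous fun s : ℝ => p + s • (q - p) := by fun_prop
    simpa using (this.tendsto 0).mono_left nhdsWithin_le_nhds
  have hev := hcont.eventually (mem_interior_iff_mem_nhds.mp hp)
  have hev2 : ∀ᶠ s : ℝ in nhdsWithin 0 (Set.Ioi 0), s < 1 :=
    nhdsWithin_le_nhds (gt_mem_nhds one_pos)
  obtain ⟨s, hsX, hs1, hs0⟩ := (hev.and (hev2.and self_mem_nhdsWithin)).exists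
  have hs0 : 0 < s := hs0
  have h1 : localModel α x y p ≤ localModel α x y (p + s • (q - p)) := hmin hsX
  rw [localModel_eq hα, localModel_eq hα, ← hq] at h1
  have h2 : p + s • (q - p) - q = (1 - s) • (p - q) := by module
  rw [h2, norm_smul, mul_pow, Real.norm_eq_abs, sq_abs] at h1
  have h3 : 1 / (2 * α) * ‖p - q‖ ^ 2 ≤ 1 / (2 * α) * ((1 - s) ^ 2 * ‖p - q‖ ^ 2) := by linarith
  have h4 := le_of_mul_le_mul_left h3 (by positivity)
  have h5 : ‖p - q‖ ^ 2 ≤ 0 := by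
    by_contra hc
    push Not at hc
    have : s * (2 - s) * ‖p - q‖ ^ 2 > 0 := mul_pos (mul_pos hs0 (by linarith)) hc
    nlinarith
  have h6 : ‖p - q‖ = 0 := by
    have := norm_nonneg (p - q)
    nlinarith
  exact sub_eq_zero.mp (norm_eq_zero.mp h6)

/-! ### Smooth functions -/

/-- The descent lemma: a quadratic upper bound along a segment on which the gradient is
Lipschitz. -/
theorem le_add_inner_add_of_lipOn {g : Vec K → ℝ} (hg : Differentiable ℝ g) {ℓ : ℝ}
    {X : Set (Vec K)} (hX : Convex ℝ X) (hlip : LipOn (gradient g) ℓ X) {p q : Vec K}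
    (hp : p ∈ X) (hq : q ∈ X) :
    g q ≤ g p + inner ℝ (gradient g p) (q - p) + ℓ / 2 * ‖q - p‖ ^ 2 := by
  set w := q - p with hw
  -- φ is g along the segment minus its linear and quadratic model; the Lipschitz bound makes φ' ≤
  -- 0, and φ(1) ≤ φ(0) is the claim.
  let φ : ℝ → ℝ := fun s => g (p + s • w) - s * inner ℝ (gradient g p) w - ℓ / 2 * s ^ 2 * ‖w‖ ^ 2
  have hline : ∀ s : ℝ, HasDerivAt (fun s : ℝ => p + s • w) w s := fun s => by
    simpa using ((hasDerivAt_id s).smul_const w).const_add p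
  have hφ : ∀ s, HasDerivAt φ (inner ℝ (gradient g (p + s • w)) w - inner ℝ (gradient g p) w
      - ℓ * s * ‖w‖ ^ 2) s := by
    intro s
    have h1 : HasDerivAt (fun s : ℝ => g (p + s • w)) (inner ℝ (gradient g (p + s • w)) w) s := by
      exact (hg (p + s • w)).hasGradientAt.hasFDerivAt.comp_hasDerivAt s (hline s)
    have h2 : HasDerivAt (fun s : ℝ => s * inner ℝ (gradient g p) w)
        (inner ℝ (gradient g p) w) s := by
      simpa using (hasDerivAt_id s).mul_const (inner ℝ (gradient g p) w)
    have h3 : HasDerivAt (fun s : ℝ => ℓ / 2 * s ^ 2 * ‖w‖ ^ 2) (ℓ * s * ‖w‖ ^ 2) s := by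
      have := (((hasDerivAt_id s).pow 2).const_mul (ℓ / 2)).mul_const (‖w‖ ^ 2)
      refine this.congr_deriv ?_
      simp only [id, Nat.add_one_sub_one, pow_one, Nat.cast_ofNat]
      ring
    exact (h1.sub h2).sub h3
  have hanti : AntitoneOn φ (Set.Icc 0 1) := by
    refine antitoneOn_of_deriv_nonpos (convex_Icc 0 1)
      (fun s _ => (hφ s).continuousAt.continuousWithinAt)
      (fun s _ => (hφ s).differentiableAt.differentiableWithinAt) fun s hs => ?_
    rw [interior_Icc] at hs
    rw [(hφ s).deriv, ← inner_sub_left]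
    have hmem : p + s • w ∈ X := hX.add_smul_sub_mem hp hq ⟨hs.1.le, hs.2.le⟩
    have h1 := hlip _ hmem _ hp
    have h2 : p + s • w - p = s • w := by abel
    rw [h2, norm_smul, Real.norm_of_nonneg hs.1.le] at h1
    have h3 := real_inner_le_norm (gradient g (p + s • w) - gradient g p) w
    have h4 := mul_le_mul_of_nonneg_right h1 (norm_nonneg w)
    nlinarith
  have h01 := hanti (Set.left_mem_Icc.mpr zero_le_one) (Set.right_mem_Icc.mpr zero_le_one)
    zero_le_one
  have e : p + w = q := by rw [hw]; abel
  simp only [φ, one_smul, zero_smul, add_zero, e] at h01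
  linarith

theorem differentiable_avgFun {f : Fin N → Vec K → ℝ} (hf : ∀ i, Differentiable ℝ (f i)) :
    Differentiable ℝ (avgFun f) := by
  unfold avgFun
  have := hf
  fun_prop

theorem gradient_avgFun {f : Fin N → Vec K → ℝ} (hf : ∀ i, Differentiable ℝ (f i)) (u : Vec K) :
    gradient (avgFun f) u = mean fun i => gradient (f i) u := by
  apply HasGradientAt.gradient
  rw [hasGradientAt_iff_hasFDerivAt]
  have h1 : HasFDerivAt (fun u => ∑ i, f i u) (∑ i, fderiv ℝ (f i) u) u :=
    HasFDerivAt.fun_sum fun i _ => (hf i u).hasFDerivAt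
  have h2 := h1.const_mul (1 / (N : ℝ))
  have e : InnerProductSpace.toDual ℝ (Vec K) (mean fun i => gradient (f i) u)
      = (1 / (N : ℝ)) • ∑ i, fderiv ℝ (f i) u := by
    simp [mean, gradient, map_sum]
  rw [e]
  exact h2

/-! ### Lipschitz constants -/

section Constants

variable {f : Fin N → Vec K → ℝ} {L : Set (Vec K) → ℝ} {Li : Fin N → Set (Vec K) → ℝ} {flow : ℝ}

theorem le_Lhat (Li : Fin N → Set (Vec K) → ℝ) (X : Set (Vec K)) (i : Fin N) :
    Li i X ≤ Lhat Li X :=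
  le_ciSup (f := fun i => Li i X) (Set.finite_range _).bddAbove i

namespace ProblemAssumption

variable (hp : ProblemAssumption f L Li flow)

include hp

theorem differentiable (i : Fin N) : Differentiable ℝ (f i) :=
  (hp.contDiff i).differentiable one_ne_zero

theorem one_le_Lhat (hN : 0 < N) {X : Set (Vec K)} (hX : IsCompact X) : 1 ≤ Lhat Li X :=
  (hp.one_le_Li ⟨0, hN⟩ X hX).trans (le_Lhat Li X _)

theorem Lhat_mono (hN : 0 < N) {X Y : Set (Vec K)} (hX : IsCompact X) (hY : IsCompact Y)
    (hXY : X ⊆ Y) : Lhat Li X ≤ Lhat Li Y := by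
  have : Nonempty (Fin N) := ⟨⟨0, hN⟩⟩
  exact ciSup_le fun i => (hp.Li_mono i X Y hX hY hXY).trans (le_Lhat Li Y i)

theorem sqNorm_gradient_sub_le {X : Set (Vec K)} (hX : IsCompact X)
    {u w : Fin N → Vec K} (hu : ∀ i, u i ∈ X) (hw : ∀ i, w i ∈ X) :
    sqNorm (fun i => gradient (f i) (u i) - gradient (f i) (w i))
      ≤ Lhat Li X ^ 2 * sqNorm (fun i => u i - w i) := by
  unfold sqNorm
  rw [Finset.mul_sum]
  refine Finset.sum_le_sum fun i _ => ?_
  rw [← mul_pow]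
  refine pow_le_pow_left₀ (norm_nonneg _) ?_ 2
  exact (hp.lip_local i X hX _ (hu i) _ (hw i)).trans
    (mul_le_mul_of_nonneg_right (le_Lhat Li X i) (norm_nonneg _))

end ProblemAssumption

end Constants

/-! ### One inner iteration -/

/-- The search direction `x̃ - x` of an inner iteration. -/
def dir (X : Set (Vec K)) (α : ℝ) (s : State N K) : Fin N → Vec K :=
  fun i => localArgmin X α (s.x i) (s.y i) - s.x i

theorem innerStep_x (f : Fin N → Vec K → ℝ) (W : Matrix (Fin N) (Fin N) ℝ) (X : Set (Vec K))
    (α β : ℝ) (s : State N K) :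
    (innerStep f W X α β s).x = mix W fun j => s.x j + β • dir X α s j := rfl

theorem innerStep_y (f : Fin N → Vec K → ℝ) (W : Matrix (Fin N) (Fin N) ℝ) (X : Set (Vec K))
    (α β : ℝ) (s : State N K) :
    (innerStep f W X α β s).y = fun i => mix W s.y i
      + (gradient (f i) ((innerStep f W X α β s).x i) - gradient (f i) (s.x i)) := by
  funext i
  simp only [innerStep, mix]
  abel

/-- The average of the trackers is the average of the local gradients. -/
def Tracks (f : Fin N → Vec K → ℝ) (s : State N K) : Prop :=
  mean s.y = mean fun i => gradient (f i) (s.x i)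

section Step

variable {f : Fin N → Vec K → ℝ} {L : Set (Vec K) → ℝ} {Li : Fin N → Set (Vec K) → ℝ} {flow : ℝ}
  {G : SimpleGraph (Fin N)} {W : Matrix (Fin N) (Fin N) ℝ}

theorem MixingMatrix.tracks_innerStep (hW : MixingMatrix G W) {X : Set (Vec K)} {α β : ℝ}
    {s : State N K} (hs : Tracks f s) : Tracks f (innerStep f W X α β s) := by
  unfold Tracks at *
  rw [innerStep_y, mean_add, hW.mean_mix, mean_sub, hs]
  abel

theorem MixingMatrix.mean_innerStep (hW : MixingMatrix G W) (X : Set (Vec K)) (α β : ℝ)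
    (s : State N K) :
    mean (innerStep f W X α β s).x = mean s.x + β • mean (dir X α s) := by
  rw [innerStep_x, hW.mean_mix, mean_add, mean_smul]

/-- Each agent moves to the midpoint of x and x̃, and mixing takes convex combinations. The larger
set Y serves stage 0, whose feasible set is a point while the iterates live in X(1). -/
theorem MixingMatrix.innerStep_mem (hW : MixingMatrix G W) {X Y : Set (Vec K)} (hX : IsCompact X)
    (hne : X.Nonempty) (hY : Convex ℝ Y) (hXY : X ⊆ Y) {α : ℝ} {s : State N K}
    (hs : ∀ i, s.x i ∈ Y) (i : Fin N) : (innerStep f W X α (1 / 2) s).x i ∈ Y := by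
  rw [innerStep_x]
  refine hW.mix_mem hY (fun j => ?_) i
  have h1 := hXY (localArgmin_spec hX hne α (s.x j) (s.y j)).1
  exact hY.add_smul_sub_mem (hs j) h1 ⟨by norm_num, by norm_num⟩

theorem consErr_tracker_le (hN : 0 < N) (hW : MixingMatrix G W)
    (hp : ProblemAssumption f L Li flow) {X Y : Set (Vec K)} (hY : IsCompact Y) {α β ξ : ℝ}
    (hξ : 0 < ξ) {s : State N K} (hs : ∀ i, s.x i ∈ Y)
    (hs' : ∀ i, (innerStep f W X α β s).x i ∈ Y) :
    consErr (innerStep f W X α β s).y ≤ (1 + ξ) * eta W ^ 2 * consErr s.y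
      + (1 + 1 / ξ) * Lhat Li Y ^ 2 * sqNorm (fun i => (innerStep f W X α β s).x i - s.x i) := by
  rw [innerStep_y]
  refine (consErr_add_le hξ _ _).trans ?_
  have h1 := mul_le_mul_of_nonneg_left (hW.consErr_mix_le hN s.y) (by positivity : 0 ≤ 1 + ξ)
  have h2 := mul_le_mul_of_nonneg_left ((consErr_le_sqNorm hN _).trans
    (hp.sqNorm_gradient_sub_le hY hs' hs)) (by positivity : 0 ≤ 1 + 1 / ξ)
  linarith

/-- With e = x - 𝟏x̄ and v = x̃ - x one has x⁺ - x = (We - e) + W(v/2), because W fixes 𝟏x̄. Now ‖We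
- e‖² ≤ 4‖e‖² and ‖W(v/2)‖² ≤ ‖v‖²/4, and squaring the sum doubles both. -/
theorem sqNorm_innerStep_sub_le (hW : MixingMatrix G W) (X : Set (Vec K)) (α : ℝ)
    (s : State N K) :
    sqNorm (fun i => (innerStep f W X α (1 / 2) s).x i - s.x i)
      ≤ 8 * consErr s.x + 1 / 2 * sqNorm (dir X α s) := by
  set e : Fin N → Vec K := fun i => s.x i - mean s.x with he
  have hx : s.x = fun i => e i + mean s.x := by funext i; simp [he]
  have h1 : (fun i => (innerStep f W X α (1 / 2) s).x i - s.x i)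
      = fun i => (mix W e i - e i) + mix W (fun j => (1 / 2 : ℝ) • dir X α s j) i := by
    rw [innerStep_x, mix_add, he, mix_sub, hW.mix_const]
    funext i
    simp only
    abel
  rw [h1]
  have h2 := sqNorm_add_le one_pos (fun i => mix W e i - e i)
    (mix W (fun j => (1 / 2 : ℝ) • dir X α s j))
  have h3 := sqNorm_sub_le (mix W e) e
  have h4 := hW.sqNorm_mix_le e
  have h5 := hW.sqNorm_mix_le (fun j => (1 / 2 : ℝ) • dir X α s j)
  rw [sqNorm_smul] at h5
  have h6 : sqNorm e = consErr s.x := rfl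
  linarith

theorem consErr_innerStep_le (hN : 0 < N) (hW : MixingMatrix G W) (X : Set (Vec K)) (α : ℝ)
    {γ : ℝ} (hγ : 0 < γ) (s : State N K) :
    consErr (innerStep f W X α (1 / 2) s).x ≤ (1 + γ) * eta W ^ 2 * consErr s.x
      + (1 + 1 / γ) * eta W ^ 2 * (1 / 4) * sqNorm (dir X α s) := by
  rw [innerStep_x]
  refine (hW.consErr_mix_le hN _).trans ?_
  have h1 := consErr_add_le hγ s.x (fun j => (1 / 2 : ℝ) • dir X α s j)
  rw [consErr_smul] at h1
  have h2 := mul_le_mul_of_nonneg_left (consErr_le_sqNorm hN (dir X α s))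
    (by positivity : 0 ≤ (1 + 1 / γ) * (1 / 2) ^ 2)
  have h3 := mul_le_mul_of_nonneg_left (h1.trans (add_le_add_right (by linarith) _) :
    _ ≤ (1 + γ) * consErr s.x + (1 + 1 / γ) * (1 / 2) ^ 2 * sqNorm (dir X α s))
    (sq_nonneg (eta W))
  linarith

/-- Descent lemma at the mean, with ∇f(x̄) = yᵢ + (ȳ - yᵢ) + (∇f(x̄) - ȳ). The first part gives the
gain by optimality of x̃ᵢ, the second costs the tracking error, and the third the consensus error
because ȳ averages the local gradients. -/
theorem avgFun_innerStep_le (hN : 0 < N) (hW : MixingMatrix G W)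
    (hp : ProblemAssumption f L Li flow) {X : Set (Vec K)} (hX : IsCompact X) (hXc : Convex ℝ X)
    (hne : X.Nonempty) {α : ℝ} (hα : 0 < α) {s : State N K} (hs : ∀ i, s.x i ∈ X)
    (ht : Tracks f s) :
    avgFun f (mean (innerStep f W X α (1 / 2) s).x) ≤ avgFun f (mean s.x)
      + 1 / (2 * N) * (-(1 / α) * sqNorm (dir X α s) + √(consErr s.y) * √(sqNorm (dir X α s))
        + Lhat Li X * √(consErr s.x) * √(sqNorm (dir X α s)))
      + Lhat Li X / (8 * N) * sqNorm (dir X α s) := by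
  have hN' : (0 : ℝ) < N := by exact_mod_cast hN
  set v := dir X α s with hv
  set g := gradient (avgFun f) (mean s.x) with hg
  have hdesc := le_add_inner_add_of_lipOn (differentiable_avgFun hp.differentiable) hXc
    (hp.lip_avg X hX) (mean_mem hXc hN hs)
    (mean_mem hXc hN (hW.innerStep_mem (f := f) hX hne hXc subset_rfl (α := α) hs))
  rw [hW.mean_innerStep, add_sub_cancel_left, ← hv, ← hg, inner_smul_right, norm_smul] at hdesc
  have hLl : 1 ≤ Lhat Li X := hp.one_le_Lhat hN hX
  have hmean : N * inner ℝ g (mean v) = ∑ i, inner ℝ g (v i) := by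
    rw [← inner_sum, sum_eq_smul_mean hN, inner_smul_right]
  have hsplit : ∑ i, inner ℝ g (v i) = ∑ i, inner ℝ (s.y i) (v i)
      + ∑ i, inner ℝ ((mean s.y - s.y i)) (v i) + ∑ i, inner ℝ (g - mean s.y) (v i) := by
    rw [← Finset.sum_add_distrib, ← Finset.sum_add_distrib]
    refine Finset.sum_congr rfl fun i _ => ?_
    rw [← inner_add_left, ← inner_add_left]
    congr 1
    abel
  have h1 : ∑ i, inner ℝ (s.y i) (v i) ≤ -(1 / α) * sqNorm v := by
    unfold sqNorm
    rw [Finset.mul_sum]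
    refine Finset.sum_le_sum fun i _ => ?_
    have hl := localArgmin_spec hX hne α (s.x i) (s.y i)
    exact inner_le_of_isMinOn hXc hα (hs i) hl.1 hl.2
  have h2 : ∑ i, inner ℝ ((mean s.y - s.y i)) (v i) ≤ √(consErr s.y) * √(sqNorm v) := by
    refine (sum_inner_le_sqrt _ _).trans_eq ?_
    congr 2
    unfold consErr sqNorm
    simp_rw [norm_sub_rev]
  have h3 : ∑ i, inner ℝ (g - mean s.y) (v i) ≤ Lhat Li X * √(consErr s.x) * √(sqNorm v) := by
    refine (sum_inner_le_sqrt (fun _ => g - mean s.y) _).trans ?_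
    refine mul_le_mul_of_nonneg_right ?_ (Real.sqrt_nonneg _)
    rw [← Real.sqrt_sq (by linarith : 0 ≤ Lhat Li X), ← Real.sqrt_mul (sq_nonneg _)]
    refine Real.sqrt_le_sqrt ?_
    have e1 : g - mean s.y
        = mean fun i => gradient (f i) (mean s.x) - gradient (f i) (s.x i) := by
      rw [mean_sub, hg, gradient_avgFun hp.differentiable, ht]
    have e2 : sqNorm (fun _ : Fin N => g - mean s.y) = N * ‖g - mean s.y‖ ^ 2 := by
      simp [sqNorm]
    rw [e2, e1]
    refine (norm_mean_sq_le hN _).trans ?_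
    refine (hp.sqNorm_gradient_sub_le hX (fun _ => mean_mem hXc hN hs) hs).trans_eq ?_
    unfold consErr sqNorm
    simp_rw [norm_sub_rev]
  have h4 : inner ℝ g (mean v) ≤ 1 / N * (-(1 / α) * sqNorm v + √(consErr s.y) * √(sqNorm v)
        + Lhat Li X * √(consErr s.x) * √(sqNorm v)) := by
    rw [one_div_mul_eq_div, le_div_iff₀ hN', mul_comm, hmean, hsplit]
    linarith
  have h5 : L X / 2 * (‖(1 / 2 : ℝ)‖ * ‖mean v‖) ^ 2 ≤ Lhat Li X / (8 * N) * sqNorm v := by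
    have e : Lhat Li X / (8 * N) * sqNorm v = Lhat Li X / 8 * (sqNorm v / N) := by
      field_simp
    rw [e, mul_pow]
    have h6 : ‖mean v‖ ^ 2 ≤ sqNorm v / N := by
      rw [le_div_iff₀ hN', mul_comm]; exact norm_mean_sq_le hN v
    have h7 := mul_le_mul (hp.L_le_Lhat X hX) h6 (sq_nonneg _) (by linarith)
    norm_num
    linarith
  have e3 : ∀ B : ℝ, 1 / (2 * (N : ℝ)) * B = 1 / 2 * (1 / N * B) := fun B => by field_simp
  rw [e3, hW.mean_innerStep]
  linarith

end Step

/-! ### Arithmetic of the potential decrease -/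

theorem mul_mul_le_of_sq_le {A B D : ℝ} (hA : 0 < A) (hD : D ^ 2 ≤ 4 * A * B) (p q : ℝ) :
    D * p * q ≤ A * p ^ 2 + B * q ^ 2 := by
  have h1 : 0 ≤ (4 * A * B - D ^ 2) * q ^ 2 := mul_nonneg (by linarith) (sq_nonneg q)
  -- The expression equals (2Ap - Dq)² + (4AB - D²)q².
  have h2 : 0 ≤ 4 * A * (A * p ^ 2 + B * q ^ 2 - D * p * q) := by
    nlinarith [sq_nonneg (2 * A * p - D * q)]
  have h3 := nonneg_of_mul_nonneg_right h2 (by linarith)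
  linarith

/-- The stepsize conditions make the potential decrease. -/
theorem potential_arith {n α ℓ γ ξ h a b c p q r : ℝ} (hn : 0 < n) (hα : 0 < α) (hℓ : 1 ≤ ℓ)
    (hγ : 0 < γ) (hξ : 0 < ξ) (hh : 0 ≤ h) (ha : a = 1 - (1 + γ) * h) (hb : b = 1 - (1 + ξ) * h)
    (ha0 : 0 < a) (hb0 : 0 < b) (hc : c = a / (32 * (1 + 1 / ξ) * ℓ ^ 2))
    (h1 : 8 * n * α * (ℓ / (2 * n) + (1 / γ + 5 / 4)) ≤ 1)
    (h2 : 64 * (1 + 1 / ξ) * ℓ ^ 2 * α ≤ n * a * b) :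
    1 / (2 * n) * (-(1 / α) * q ^ 2 + p * q + ℓ * r * q) + ℓ / (8 * n) * q ^ 2
      + ((1 + γ) * h * r ^ 2 + (1 + 1 / γ) * h * (1 / 4) * q ^ 2)
      + c * ((1 + ξ) * h * p ^ 2 + (1 + 1 / ξ) * ℓ ^ 2 * (8 * r ^ 2 + 1 / 2 * q ^ 2))
      ≤ r ^ 2 + c * p ^ 2 - (1 / (4 * n * α) * q ^ 2 + a / 2 * r ^ 2 + c * b / 2 * p ^ 2) := by
  set k := (1 + 1 / ξ) * ℓ ^ 2 with hk
  have hℓ2 : 1 ≤ ℓ ^ 2 := one_le_pow₀ hℓ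
  have hξ' : 0 < 1 / ξ := by positivity
  have hkℓ : ℓ ^ 2 ≤ k := by rw [hk]; nlinarith
  have hk0 : 0 < k := by linarith
  have hc' : c = a / (32 * k) := by rw [hc, hk]; ring_nf
  have h2' : 64 * (k * α) ≤ n * a * b := by rw [hk]; linarith
  have hck : c * k = a / 32 := by rw [hc']; field_simp
  have hc0 : 0 < c := by rw [hc']; positivity
  have hb1 : b ≤ 1 := by rw [hb]; nlinarith
  have ha1 : a ≤ 1 := by rw [ha]; nlinarith
  have hh1 : h ≤ 1 := by nlinarith
  -- The budget: descent supplies w/2 of q², of which `t1`, `t2`, `t3` spend w/16, w/64 and w/32, so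
  -- w/4 can be kept. For p², `t1` spends half of the contraction cb. For r², the tracker (8ck =
  -- a/4) and `t2` (a/4) spend half of a.
  set w := 1 / (n * α) with hw
  have hw0 : 0 < w := by positivity
  have hwn : w * (n * α) = 1 := by rw [hw]; field_simp
  have t1 : 1 / (2 * n) * p * q ≤ c * b / 2 * p ^ 2 + w / 16 * q ^ 2 := by
    refine mul_mul_le_of_sq_le (by positivity) ?_ p q
    have e : (1 / (2 * n)) ^ 2 = w * (α / (4 * n)) := by rw [hw]; field_simp; norm_num
    have e2 : 4 * (c * b / 2) * (w / 16) = w * (c * b / 8) := by ring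
    rw [e, e2]
    refine mul_le_mul_of_nonneg_left ?_ hw0.le
    rw [hc', div_mul_eq_mul_div, div_div, div_le_div_iff₀ (by positivity) (by positivity)]
    linarith
  have t2 : ℓ / (2 * n) * r * q ≤ a / 4 * r ^ 2 + w / 64 * q ^ 2 := by
    refine mul_mul_le_of_sq_le (by positivity) ?_ r q
    have e : (ℓ / (2 * n)) ^ 2 = w * (α * ℓ ^ 2 / (4 * n)) := by rw [hw]; field_simp; norm_num
    have e2 : 4 * (a / 4) * (w / 64) = w * (a / 64) := by ring
    rw [e, e2]
    refine mul_le_mul_of_nonneg_left ?_ hw0.le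
    rw [div_le_div_iff₀ (by positivity) (by positivity)]
    have h3 : ℓ ^ 2 * α ≤ k * α := mul_le_mul_of_nonneg_right hkℓ hα.le
    have h4 : n * a * b ≤ n * a := mul_le_of_le_one_right (by positivity) hb1
    have h5 : 0 < n * a := by positivity
    linarith
  have t3 : ℓ / (8 * n) + (1 + 1 / γ) * h * (1 / 4) + a / 64 ≤ w / 32 := by
    have hs : ℓ / (2 * n) + (1 / γ + 5 / 4) ≤ w / 8 := by
      rw [hw, div_div, le_div_iff₀ (by positivity)]
      linarith
    have h3 : (1 + 1 / γ) * h ≤ 1 + 1 / γ := mul_le_of_le_one_right (by positivity) hh1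
    have e : ℓ / (8 * n) = ℓ / (2 * n) / 4 := by field_simp; norm_num
    rw [e]
    linarith
  have t3q := mul_le_mul_of_nonneg_right t3 (sq_nonneg q)
  have e1 : 1 / (2 * n) * (-(1 / α) * q ^ 2 + p * q + ℓ * r * q)
      = -(w / 2) * q ^ 2 + 1 / (2 * n) * p * q + ℓ / (2 * n) * r * q := by
    rw [hw]; field_simp
  have e2 : 1 / (4 * n * α) * q ^ 2 = w / 4 * q ^ 2 := by rw [hw]; field_simp
  have e3 : c * ((1 + ξ) * h * p ^ 2 + k * (8 * r ^ 2 + 1 / 2 * q ^ 2))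
      = c * (1 - b) * p ^ 2 + (a / 4 * r ^ 2 + a / 64 * q ^ 2) := by
    have : c * (k * (8 * r ^ 2 + 1 / 2 * q ^ 2)) = a / 32 * (8 * r ^ 2 + 1 / 2 * q ^ 2) := by
      rw [← mul_assoc, hck]
    rw [mul_add, this, hb]
    ring
  have e4 : (1 + γ) * h * r ^ 2 = (1 - a) * r ^ 2 := by rw [ha]; ring
  rw [e1, e2, e3, e4]
  have hq0 : 0 ≤ w * q ^ 2 := by positivity
  linarith

/-! ### Runs of the algorithm -/

namespace Input

/-- The standing assumptions on a run of the algorithm with radii `t d`. -/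
structure Standing (A : Input N K) (G : SimpleGraph (Fin N)) (L : Set (Vec K) → ℝ) (flow d : ℝ) :
    Prop where
  hN : 0 < N
  γ_pos : 0 < A.γ
  ξ_pos : 0 < A.ξ
  a_pos : 0 < A.a
  b_pos : 0 < A.b
  mixing : MixingMatrix G A.W
  problem : ProblemAssumption A.f L A.Li flow
  d_pos : 0 < d
  v_eq : ∀ t, A.v t = t * d
  acc_pos : 0 < A.acc
  acc_lt : A.acc < 2 * A.a
  x0_mem : ∀ i, A.x0 i ∈ Metric.closedBall (mean A.x0) d

theorem isCompact_X (A : Input N K) (t : ℕ) : IsCompact (A.X t) := isCompact_closedBall _ _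

theorem convex_X (A : Input N K) (t : ℕ) : Convex ℝ (A.X t) := convex_closedBall _ _

/-- The weight of the tracking error in the potential. -/
def wt (A : Input N K) (t : ℕ) : ℝ := A.a / (32 * (1 + 1 / A.ξ) * A.Lh t ^ 2)

/-- The search direction of the `r`-th inner iteration of stage `t`. -/
def step (A : Input N K) (t r : ℕ) : Fin N → Vec K := dir (A.X t) (A.α t) (A.iter t r)

/-- The guaranteed decrease of the potential in the `r`-th inner iteration of stage `t`. -/
def drop (A : Input N K) (t r : ℕ) : ℝ :=
  1 / (4 * N * A.α t) * sqNorm (A.step t r) + A.a / 2 * consErr (A.iter t r).x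
    + A.wt t * A.b / 2 * consErr (A.iter t r).y

/-- The guaranteed decrease of the potential in stage `t`. -/
def stageDrop (A : Input N K) (t : ℕ) : ℝ := ∑ r ∈ Finset.range (A.R t), A.drop t r

theorem α_le_one (A : Input N K) (t : ℕ) : A.α t ≤ 1 := min_le_right _ _

theorem P_eq (A : Input N K) (s : State N K) (t : ℕ) :
    A.P s t = avgFun A.f (mean s.x) + consErr s.x + A.wt t * consErr s.y := rfl

theorem iter_zero (A : Input N K) (t : ℕ) : A.iter t 0 = A.state t := rfl

theorem iter_succ (A : Input N K) (t r : ℕ) :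
    A.iter t (r + 1) = innerStep A.f A.W (A.X t) (A.α t) (1 / 2) (A.iter t r) :=
  Function.iterate_succ_apply' _ _ _

theorem iter_R (A : Input N K) (t : ℕ) : A.iter t (A.R t) = A.state (t + 1) := rfl

namespace Standing

variable {A : Input N K} {G : SimpleGraph (Fin N)} {L : Set (Vec K) → ℝ} {flow d : ℝ}
  (h : A.Standing G L flow d)

include h

theorem mean_mem_X (t : ℕ) : mean A.x0 ∈ A.X t := by
  have := h.d_pos
  exact Metric.mem_closedBall_self (by rw [h.v_eq]; positivity)

theorem X_mono {s t : ℕ} (hst : s ≤ t) : A.X s ⊆ A.X t := by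
  refine Metric.closedBall_subset_closedBall ?_
  rw [h.v_eq, h.v_eq]
  have : (s : ℝ) ≤ t := by exact_mod_cast hst
  exact mul_le_mul_of_nonneg_right this h.d_pos.le

theorem one_le_Lh (t : ℕ) : 1 ≤ A.Lh t := h.problem.one_le_Lhat h.hN (A.isCompact_X t)

theorem Lh_mono {s t : ℕ} (hst : s ≤ t) : A.Lh s ≤ A.Lh t :=
  h.problem.Lhat_mono h.hN (A.isCompact_X s) (A.isCompact_X t) (h.X_mono hst)

theorem a_le_one : A.a ≤ 1 := by
  have := h.γ_pos
  have : 0 ≤ (1 + A.γ) * eta A.W ^ 2 := by positivity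
  unfold a
  linarith

theorem wt_pos (t : ℕ) : 0 < A.wt t := by
  have h1 := h.ξ_pos
  have h2 := h.a_pos
  have h3 := h.one_le_Lh t
  unfold wt
  positivity

theorem wt_anti {s t : ℕ} (hst : s ≤ t) : A.wt t ≤ A.wt s := by
  have h1 := h.ξ_pos
  have h2 := h.a_pos
  have h3 := h.one_le_Lh s
  have h4 := h.Lh_mono hst
  unfold wt
  gcongr

/-! ### Stepsizes -/

theorem α_pos (t : ℕ) : 0 < A.α t := by
  have := h.γ_pos
  have := h.ξ_pos
  have := h.a_pos
  have := h.b_pos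
  have := h.one_le_Lh t
  have : (0 : ℝ) < N := by exact_mod_cast h.hN
  unfold α
  refine lt_min (lt_min ?_ ?_) one_pos <;> positivity

theorem α_cond_linear (t : ℕ) :
    8 * N * A.α t * (A.Lh t / (2 * N) + (1 / A.γ + 5 / 4)) ≤ 1 := by
  have := h.γ_pos
  have := h.one_le_Lh t
  have hN : (0 : ℝ) < N := by exact_mod_cast h.hN
  have h1 : A.α t ≤ _ := (min_le_left _ _).trans (min_le_left _ _)
  have h2 : 0 < A.Lh t / (2 * N) + (1 / A.γ + 5 / 4) := by positivity
  set B := A.Lh t / (2 * N) + (1 / A.γ + 5 / 4)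
  calc 8 * N * A.α t * B ≤ 8 * N * (1 / (8 * N) * (1 / B)) * B := by gcongr
    _ = 1 := by field_simp

theorem α_cond_quadratic (t : ℕ) :
    64 * (1 + 1 / A.ξ) * A.Lh t ^ 2 * A.α t ≤ N * A.a * A.b := by
  have := h.ξ_pos
  have := h.one_le_Lh t
  have h1 : A.α t ≤ _ := (min_le_left _ _).trans (min_le_right _ _)
  rw [le_div_iff₀ (by positivity)] at h1
  linarith

/-- The summand 5/4 in the stepsize gives 8 · 5/4 = 10. -/
theorem ten_mul_α_le (t : ℕ) : 10 * N * A.α t ≤ 1 := by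
  have h1 := h.α_cond_linear t
  have := h.γ_pos
  have := h.one_le_Lh t
  have hN : (0 : ℝ) < N := by exact_mod_cast h.hN
  have h2 : 5 / 4 ≤ A.Lh t / (2 * N) + (1 / A.γ + 5 / 4) := by
    have : 0 ≤ A.Lh t / (2 * N) + 1 / A.γ := by positivity
    linarith
  have h3 := mul_le_mul_of_nonneg_left h2 (by have := h.α_pos t; positivity : 0 ≤ 8 * N * A.α t)
  linarith

theorem one_le_R_mul (t : ℕ) : 1 ≤ A.R t * (A.acc * A.α t) := by
  have h1 := mul_pos h.acc_pos (h.α_pos t)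
  have h2 := Nat.le_ceil (1 / (A.acc * A.α t))
  rwa [div_le_iff₀ h1] at h2

theorem R_pos (t : ℕ) : (0 : ℝ) < A.R t := by
  have h1 := mul_pos h.acc_pos (h.α_pos t)
  exact pos_of_mul_pos_left (one_pos.trans_le (h.one_le_R_mul t)) h1.le

/-- Rounding up adds at most acc·α ≤ 2 · 1/10. -/
theorem R_mul_le (t : ℕ) : A.R t * (A.acc * A.α t) ≤ 6 / 5 := by
  have h1 := mul_pos h.acc_pos (h.α_pos t)
  have h2 := (Nat.ceil_lt_add_one (a := 1 / (A.acc * A.α t)) (by positivity)).le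
  have h3 := mul_le_mul_of_nonneg_right h2 h1.le
  have h4 : (1 / (A.acc * A.α t) + 1) * (A.acc * A.α t) = 1 + A.acc * A.α t := by
    rw [add_mul, one_div_mul_cancel h1.ne', one_mul]
  rw [h4] at h3
  have h5 := h.ten_mul_α_le t
  have hN : (1 : ℝ) ≤ N := by exact_mod_cast h.hN
  have h6 : 10 * A.α t ≤ 1 := by
    have := mul_le_mul_of_nonneg_right hN (h.α_pos t).le
    linarith
  have h7 : A.acc * A.α t ≤ 2 * A.α t :=
    mul_le_mul_of_nonneg_right (by linarith [h.acc_lt, h.a_le_one]) (h.α_pos t).le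
  refine h3.trans ?_
  linarith

/-! ### Invariants of the iteration -/

theorem iter_mem {t : ℕ} {Y : Set (Vec K)} (hY : Convex ℝ Y) (hXY : A.X t ⊆ Y)
    (hs : ∀ i, (A.state t).x i ∈ Y) (r : ℕ) : ∀ i, (A.iter t r).x i ∈ Y := by
  induction r with
  | zero => exact hs
  | succ r ih =>
    rw [iter_succ]
    exact h.mixing.innerStep_mem (A.isCompact_X t) ⟨_, h.mean_mem_X t⟩ hY hXY ih

theorem state_zero_mem (i : Fin N) : (A.state 0).x i ∈ A.X 1 := by
  change A.x0 i ∈ Metric.closedBall (mean A.x0) (A.v 1)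
  simpa [h.v_eq] using h.x0_mem i

theorem state_succ_mem (t : ℕ) : ∀ i, (A.state (t + 1)).x i ∈ A.X (t + 1) := by
  induction t with
  | zero =>
    rw [← iter_R]
    exact h.iter_mem (A.convex_X 1) (h.X_mono zero_le_one) h.state_zero_mem _
  | succ t ih =>
    intro i
    rw [← iter_R]
    exact h.X_mono (Nat.le_succ _) (h.iter_mem (A.convex_X _) subset_rfl ih _ i)

theorem iter_succ_mem (t r : ℕ) (i : Fin N) : (A.iter (t + 1) r).x i ∈ A.X (t + 1) :=
  h.iter_mem (A.convex_X _) subset_rfl (h.state_succ_mem t) r i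

theorem tracks_iter_of_state {t : ℕ} (hs : Tracks A.f (A.state t)) (r : ℕ) :
    Tracks A.f (A.iter t r) := by
  induction r with
  | zero => exact hs
  | succ r ih => rw [iter_succ]; exact h.mixing.tracks_innerStep ih

theorem tracks_state (t : ℕ) : Tracks A.f (A.state t) := by
  induction t with
  | zero => rfl
  | succ t ih => exact h.tracks_iter_of_state ih _

theorem tracks_iter (t r : ℕ) : Tracks A.f (A.iter t r) :=
  h.tracks_iter_of_state (h.tracks_state t) r

theorem localArgmin_stage_zero (x y : Vec K) : localArgmin (A.X 0) (A.α 0) x y = mean A.x0 := by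
  have h1 := (localArgmin_spec (A.isCompact_X 0) ⟨_, h.mean_mem_X 0⟩ (A.α 0) x y).1
  simpa [X, h.v_eq] using h1

theorem step_zero (r : ℕ) : A.step 0 r = fun i => mean A.x0 - (A.iter 0 r).x i := by
  funext i
  simp only [step, dir, h.localArgmin_stage_zero]

/-- In stage 0 every x̃ᵢ is the centre z, so the directions z - xᵢ average to zero. -/
theorem mean_iter_zero (r : ℕ) : mean (A.iter 0 r).x = mean A.x0 := by
  induction r with
  | zero => rfl
  | succ r ih =>
    have h1 : mean (dir (A.X 0) (A.α 0) (A.iter 0 r)) = 0 := by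
      have := h.step_zero r
      rw [step] at this
      rw [this, mean_sub, mean_const h.hN, ih, sub_self]
    rw [iter_succ, h.mixing.mean_innerStep, ih, h1, smul_zero, add_zero]

/-- Stage t + 1 thus starts with a margin d between the mean and the boundary of its ball. After
stage 0 this is asserted of the mean only, as the agents need not have reached z. -/
theorem mean_state_succ_mem (t : ℕ) : mean (A.state (t + 1)).x ∈ A.X t := by
  rw [← iter_R]
  cases t with
  | zero => rw [h.mean_iter_zero]; exact h.mean_mem_X 0
  | succ t => exact mean_mem (A.convex_X _) h.hN fun i => h.iter_succ_mem t _ i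

/-! ### Decrease of the potential -/

theorem P_iter_succ_add_drop_le (t r : ℕ) :
    A.P (A.iter (t + 1) (r + 1)) (t + 1) + A.drop (t + 1) r
      ≤ A.P (A.iter (t + 1) r) (t + 1) := by
  have hN : (0 : ℝ) < N := by exact_mod_cast h.hN
  have hs := h.iter_succ_mem t r
  have hs' := h.iter_succ_mem t (r + 1)
  rw [iter_succ] at hs' ⊢
  rw [P_eq, P_eq, drop, step]
  set s := A.iter (t + 1) r
  have h1 := avgFun_innerStep_le h.hN h.mixing h.problem (A.isCompact_X (t + 1))
    (A.convex_X (t + 1)) ⟨_, h.mean_mem_X _⟩ (h.α_pos (t + 1)) hs (h.tracks_iter (t + 1) r)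
  have h2 := consErr_innerStep_le (f := A.f) h.hN h.mixing (A.X (t + 1)) (A.α (t + 1)) h.γ_pos s
  have h3 := consErr_tracker_le h.hN h.mixing h.problem (A.isCompact_X (t + 1)) h.ξ_pos hs hs'
  have h4 := sqNorm_innerStep_sub_le (f := A.f) h.mixing (A.X (t + 1)) (A.α (t + 1)) s
  have h0 := potential_arith (p := √(consErr s.y))
    (q := √(sqNorm (dir (A.X (t + 1)) (A.α (t + 1)) s))) (r := √(consErr s.x)) hN
    (h.α_pos (t + 1)) (h.one_le_Lh (t + 1)) h.γ_pos h.ξ_pos (sq_nonneg (eta A.W)) (rfl : A.a = _)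
    (rfl : A.b = _) h.a_pos h.b_pos (rfl : A.wt (t + 1) = _) (h.α_cond_linear (t + 1)) (h.α_cond_quadratic (t + 1))
  rw [Real.sq_sqrt (consErr_nonneg _), Real.sq_sqrt (consErr_nonneg _),
    Real.sq_sqrt (sqNorm_nonneg _)] at h0
  have hw := h.wt_pos (t + 1)
  change _ ≤ _ + (1 + 1 / A.ξ) * A.Lh (t + 1) ^ 2 * _ at h3
  have h5 := mul_le_mul_of_nonneg_left h4
    (by have := h.ξ_pos; positivity : 0 ≤ (1 + 1 / A.ξ) * A.Lh (t + 1) ^ 2)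
  have h6 := mul_le_mul_of_nonneg_left (h3.trans (add_le_add_right h5 _)) hw.le
  change avgFun A.f (mean (innerStep A.f A.W (A.X (t + 1)) (A.α (t + 1)) (1 / 2) s).x) ≤
    avgFun A.f (mean s.x) + 1 / (2 * N) * (-(1 / A.α (t + 1)) *
      sqNorm (dir (A.X (t + 1)) (A.α (t + 1)) s) + √(consErr s.y) *
      √(sqNorm (dir (A.X (t + 1)) (A.α (t + 1)) s)) + A.Lh (t + 1) * √(consErr s.x) *
      √(sqNorm (dir (A.X (t + 1)) (A.α (t + 1)) s)))
      + A.Lh (t + 1) / (8 * N) * sqNorm (dir (A.X (t + 1)) (A.α (t + 1)) s) at h1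
  linarith

theorem P_iter_add_sum_drop_le (t r : ℕ) :
    A.P (A.iter (t + 1) r) (t + 1) + ∑ k ∈ Finset.range r, A.drop (t + 1) k
      ≤ A.P (A.state (t + 1)) (t + 1) := by
  induction r with
  | zero => simp [iter_zero]
  | succ r ih =>
    rw [Finset.sum_range_succ]
    linarith [h.P_iter_succ_add_drop_le t r]

/-- A larger ball has a larger L̂, hence a smaller tracking weight; this lets the stages telescope.
-/
theorem P_succ_le (s : State N K) (t : ℕ) : A.P s (t + 1) ≤ A.P s t := by
  have h1 := mul_le_mul_of_nonneg_right (h.wt_anti (Nat.le_succ t)) (consErr_nonneg s.y)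
  unfold wt at h1
  unfold P
  linarith

theorem P_state_add_sum_stageDrop_le (T : ℕ) :
    A.P (A.state (T + 1)) (T + 1) + ∑ t ∈ Finset.range T, A.stageDrop (t + 1)
      ≤ A.P (A.state 1) 1 := by
  induction T with
  | zero => simp
  | succ T ih =>
    rw [Finset.sum_range_succ]
    have h1 := h.P_iter_add_sum_drop_le T (A.R (T + 1))
    rw [iter_R] at h1
    have h2 := h.P_succ_le (A.state (T + 1 + 1)) (T + 1)
    unfold stageDrop at *
    linarith

theorem lt_P (s : State N K) (t : ℕ) : flow < A.P s t := by
  have h1 := h.problem.lower (mean s.x)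
  have h2 := consErr_nonneg s.x
  have h3 := mul_nonneg (h.wt_pos t).le (consErr_nonneg s.y)
  unfold wt at h3
  unfold P
  linarith

/-- Pigeonhole: otherwise the stages together would push the potential below `flow`. -/
theorem exists_stageDrop_le {T : ℕ} (hT : 0 < T) :
    ∃ t < T, T * A.stageDrop (t + 1) ≤ A.P (A.state 1) 1 - flow := by
  by_contra! hc
  have h1 := h.P_state_add_sum_stageDrop_le T
  have h2 := h.lt_P (A.state (T + 1)) (T + 1)
  have hT' : (0 : ℝ) < T := by exact_mod_cast hT
  have h3 : ∑ _t ∈ Finset.range T, (A.P (A.state 1) 1 - flow)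
      < ∑ t ∈ Finset.range T, T * A.stageDrop (t + 1) :=
    Finset.sum_lt_sum_of_nonempty (by simpa using hT.ne') fun t ht => hc t (Finset.mem_range.mp ht)
  rw [Finset.sum_const, Finset.card_range, nsmul_eq_mul, ← Finset.mul_sum] at h3
  have h4 := lt_of_mul_lt_mul_left h3 hT'.le
  linarith

end Standing
end Input

/-! ### Constants independent of the run -/

/-- The factor in the bound of the averaged gap. -/
def gapConst (N : ℕ) (a : ℝ) : ℝ := 5 * N + 2 / a

/-- The factor in the bound of the reciprocal stepsize by the squared Lipschitz constant. -/
def stepConst (N : ℕ) (γ ξ a b : ℝ) : ℝ :=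
  8 * N * (1 / (2 * N) + (1 / γ + 5 / 4)) + 64 * (1 + 1 / ξ) / (N * a * b) + 1

theorem gapConst_pos {N : ℕ} (hN : 0 < N) {a : ℝ} (ha : 0 < a) : 0 < gapConst N a := by
  unfold gapConst
  positivity

theorem stepConst_pos {N : ℕ} {γ ξ a b : ℝ} (hγ : 0 < γ) (hξ : 0 < ξ) (ha : 0 < a)
    (hb : 0 < b) : 0 < stepConst N γ ξ a b := by
  unfold stepConst
  positivity

namespace Input.Standing

variable {A : Input N K} {G : SimpleGraph (Fin N)} {L : Set (Vec K) → ℝ} {flow d : ℝ}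
  (h : A.Standing G L flow d)

include h

/-! ### Stages with a small decrease -/

theorem drop_terms_nonneg (t r : ℕ) : 0 ≤ 1 / (4 * N * A.α t) * sqNorm (A.step t r) ∧
    0 ≤ A.a / 2 * consErr (A.iter t r).x ∧ 0 ≤ A.wt t * A.b / 2 * consErr (A.iter t r).y := by
  have := h.α_pos t
  have := h.a_pos
  have := h.b_pos
  have := h.wt_pos t
  have := sqNorm_nonneg (A.step t r)
  have := consErr_nonneg (A.iter t r).x
  have := consErr_nonneg (A.iter t r).y
  refine ⟨?_, ?_, ?_⟩ <;> positivity

theorem drop_nonneg (t r : ℕ) : 0 ≤ A.drop t r := by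
  obtain ⟨h1, h2, h3⟩ := h.drop_terms_nonneg t r
  unfold drop
  positivity

theorem stageDrop_nonneg (t : ℕ) : 0 ≤ A.stageDrop t :=
  Finset.sum_nonneg fun r _ => h.drop_nonneg t r

theorem drop_le_stageDrop {t r : ℕ} (hr : r < A.R t) : A.drop t r ≤ A.stageDrop t :=
  Finset.single_le_sum (f := A.drop t) (fun k _ => h.drop_nonneg t k) (Finset.mem_range.mpr hr)

theorem sqNorm_step_le_drop (t r : ℕ) : sqNorm (A.step t r) ≤ 4 * N * A.α t * A.drop t r := by
  have hN : (0 : ℝ) < N := by exact_mod_cast h.hN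
  have hα := h.α_pos t
  obtain ⟨h1, h2, h3⟩ := h.drop_terms_nonneg t r
  have h4 : 1 / (4 * N * A.α t) * sqNorm (A.step t r) ≤ A.drop t r := by
    unfold drop
    linarith
  rwa [one_div_mul_eq_div, div_le_iff₀ (by positivity), mul_comm] at h4

theorem consErr_x_le_drop (t r : ℕ) : consErr (A.iter t r).x ≤ 2 / A.a * A.drop t r := by
  obtain ⟨h1, h2, h3⟩ := h.drop_terms_nonneg t r
  have h4 : A.a / 2 * consErr (A.iter t r).x ≤ A.drop t r := by
    unfold drop
    linarith
  rw [div_mul_eq_mul_div, le_div_iff₀ h.a_pos]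
  linarith

/-- The quadratic stepsize condition says exactly that α/N is at most half the tracking weight times
b. The factor N/α then has the same order in α as the one for ‖y‖². -/
theorem consErr_y_le_drop (t r : ℕ) :
    consErr (A.iter t r).y ≤ N / A.α t * A.drop t r := by
  obtain ⟨h1, h2, h3⟩ := h.drop_terms_nonneg t r
  have h4 : A.wt t * A.b / 2 * consErr (A.iter t r).y ≤ A.drop t r := by
    unfold drop
    linarith
  have h5 : A.α t / N ≤ A.wt t * A.b / 2 := by
    have hN : (0 : ℝ) < N := by exact_mod_cast h.hN
    have := h.ξ_pos
    have := h.one_le_Lh t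
    have := h.α_cond_quadratic t
    rw [wt, div_mul_eq_mul_div, div_div, div_le_div_iff₀ hN (by positivity)]
    linarith
  have h6 := (mul_le_mul_of_nonneg_right h5 (consErr_nonneg (A.iter t r).y)).trans h4
  have hN : (0 : ℝ) < N := by exact_mod_cast h.hN
  have hα := h.α_pos t
  rw [div_mul_eq_mul_div, div_le_iff₀ hN] at h6
  rw [div_mul_eq_mul_div, le_div_iff₀ hα]
  linarith

theorem dist_mean_iter_le (t r : ℕ) :
    ‖mean (A.iter t r).x - mean (A.state t).x‖
      ≤ ∑ k ∈ Finset.range r, 1 / 2 * ‖mean (A.step t k)‖ := by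
  induction r with
  | zero => simp [iter_zero]
  | succ r ih =>
    rw [iter_succ, h.mixing.mean_innerStep, Finset.sum_range_succ]
    have e : ∀ p q w : Vec K, p + w - q = (p - q) + w := fun p q w => by abel
    rw [e]
    refine (norm_add_le _ _).trans (add_le_add ih ?_)
    rw [norm_smul]
    norm_num
    rfl

/-- Cauchy-Schwarz over the R steps, with N‖v̄‖² ≤ ‖v‖² ≤ 4Nα·`drop`, where v = x̃ - x. As Rα is
about 1/acc, the drift allowed by a given drop does not depend on α. -/
theorem dist_mean_iter_sq_le {t r : ℕ} (hr : r ≤ A.R t) :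
    ‖mean (A.iter t r).x - mean (A.state t).x‖ ^ 2 ≤ A.R t * A.α t * A.stageDrop t := by
  have hN : (0 : ℝ) < N := by exact_mod_cast h.hN
  have h1 : ∑ k ∈ Finset.range r, 1 / 2 * ‖mean (A.step t k)‖
      ≤ ∑ k ∈ Finset.range (A.R t), 1 / 2 * ‖mean (A.step t k)‖ :=
    Finset.sum_le_sum_of_subset_of_nonneg (Finset.range_mono hr) fun _ _ _ => by positivity
  have h2 := pow_le_pow_left₀ (norm_nonneg _) ((h.dist_mean_iter_le t r).trans h1) 2
  refine h2.trans ((sq_sum_le_card_mul_sum_sq).trans ?_)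
  rw [Finset.card_range, mul_assoc]
  refine mul_le_mul_of_nonneg_left ?_ (Nat.cast_nonneg _)
  rw [stageDrop, Finset.mul_sum]
  refine Finset.sum_le_sum fun k _ => ?_
  have h3 := (norm_mean_sq_le h.hN (A.step t k)).trans (h.sqNorm_step_le_drop t k)
  have h4 : N * (4 * (1 / 2 * ‖mean (A.step t k)‖) ^ 2) ≤ N * (4 * (A.α t * A.drop t k)) := by
    linarith
  linarith [le_of_mul_le_mul_left h4 hN]

/-- If the potential decreases by little in a stage, then the constraint is never active. -/
theorem step_eq_of_stageDrop_le {t r : ℕ}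
    (hD : A.stageDrop (t + 1) ≤ A.acc * d ^ 2 / 128) (hr : r < A.R (t + 1)) (i : Fin N) :
    A.step (t + 1) r i = -(A.α (t + 1) • (A.iter (t + 1) r).y i) := by
  have hd := h.d_pos
  have hα := h.α_pos (t + 1)
  have ha := h.a_pos
  have hacc := h.acc_pos
  have hacc2 : A.acc < 2 := by linarith [h.acc_lt, h.a_le_one]
  have hdr := h.drop_le_stageDrop hr
  have hdr0 := h.drop_nonneg (t + 1) r
  have hD0 := h.stageDrop_nonneg (t + 1)
  have hd2 : 0 < d ^ 2 := by positivity
  have hDd : A.stageDrop (t + 1) ≤ d ^ 2 / 64 := by nlinarith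
  -- The displacements d/10, d/5, d/10 of `b1`, `b2`, `b3` sum to 2d/5, below the margin d between
  -- consecutive radii.
  have b1 : ‖A.step (t + 1) r i‖ ≤ d / 10 := by
    refine abs_le_of_sq_le_sq' ?_ (by positivity) |>.2
    refine (norm_sq_le_sqNorm _ i).trans ((h.sqNorm_step_le_drop _ r).trans ?_)
    have h1 := h.ten_mul_α_le (t + 1)
    have h2 := mul_le_mul_of_nonneg_right h1 hdr0
    nlinarith
  -- The condition acc < 2a cancels the factor 2/a: the square is at most 4d²/128.
  have b2 : ‖(A.iter (t + 1) r).x i - mean (A.iter (t + 1) r).x‖ ≤ d / 5 := by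
    refine abs_le_of_sq_le_sq' ?_ (by positivity) |>.2
    refine (norm_sub_mean_sq_le _ i).trans ((h.consErr_x_le_drop _ r).trans ?_)
    rw [div_mul_eq_mul_div, div_le_iff₀ ha]
    have h1 := mul_le_mul_of_nonneg_right h.acc_lt.le hd2.le
    nlinarith [mul_pos ha hd2]
  -- The square is at most (6/5)d²/128 < d²/100.
  have b3 : ‖mean (A.iter (t + 1) r).x - mean (A.state (t + 1)).x‖ ≤ d / 10 := by
    refine abs_le_of_sq_le_sq' ?_ (by positivity) |>.2
    refine (h.dist_mean_iter_sq_le hr.le).trans ?_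
    have h1 := h.R_mul_le (t + 1)
    have h2 : 0 ≤ (A.R (t + 1) : ℝ) * A.α (t + 1) := by positivity
    have h3 := mul_le_mul_of_nonneg_left hD h2
    have h4 := mul_le_mul_of_nonneg_right h1 hd2.le
    nlinarith
  have b4 : ‖mean (A.state (t + 1)).x - mean A.x0‖ ≤ t * d := by
    have := h.mean_state_succ_mem t
    rwa [X, h.v_eq, mem_closedBall_iff_norm] at this
  set s := A.iter (t + 1) r with hs
  set p := localArgmin (A.X (t + 1)) (A.α (t + 1)) (s.x i) (s.y i) with hp
  have hstep : A.step (t + 1) r i = p - s.x i := rfl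
  have hspec := localArgmin_spec (A.isCompact_X (t + 1)) ⟨_, h.mean_mem_X (t + 1)⟩
    (A.α (t + 1)) (s.x i) (s.y i)
  rw [hstep]
  refine sub_eq_of_isMinOn_of_mem_interior hα ?_ hspec.2
  refine interior_mono (s := Metric.ball (mean A.x0) (A.v (t + 1))) Metric.ball_subset_closedBall ?_
  rw [Metric.isOpen_ball.interior_eq, mem_ball_iff_norm, h.v_eq]
  have e : p - mean A.x0 = (p - s.x i) + (s.x i - mean s.x)
      + (mean s.x - mean (A.state (t + 1)).x) + (mean (A.state (t + 1)).x - mean A.x0) := by abel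
  rw [hstep] at b1
  rw [e]
  have n1 := norm_add_le ((p - s.x i) + (s.x i - mean s.x)
      + (mean s.x - mean (A.state (t + 1)).x)) (mean (A.state (t + 1)).x - mean A.x0)
  have n2 := norm_add_le ((p - s.x i) + (s.x i - mean s.x))
    (mean s.x - mean (A.state (t + 1)).x)
  have n3 := norm_add_le (p - s.x i) (s.x i - mean s.x)
  push_cast
  linarith

theorem avgGap_le_of_stageDrop_le {t : ℕ} (hD : A.stageDrop (t + 1) ≤ A.acc * d ^ 2 / 128) :
    A.avgGap (t + 1) ≤ gapConst N A.a * A.stageDrop (t + 1) * A.acc := by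
  have hα := h.α_pos (t + 1)
  have ha := h.a_pos
  have hN : (0 : ℝ) < N := by exact_mod_cast h.hN
  have hR := h.R_pos (t + 1)
  have hterm : ∀ r ∈ Finset.range (A.R (t + 1)),
      sqNorm (A.iter (t + 1) r).y + consErr (A.iter (t + 1) r).x + consErr (A.iter (t + 1) r).y
        ≤ gapConst N A.a / A.α (t + 1) * A.drop (t + 1) r := by
    intro r hr
    have hd0 := h.drop_nonneg (t + 1) r
    have h1 : sqNorm (A.iter (t + 1) r).y ≤ 4 * N / A.α (t + 1) * A.drop (t + 1) r := by
      have e : A.step (t + 1) r = fun i => (-A.α (t + 1)) • (A.iter (t + 1) r).y i := by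
        funext i
        rw [h.step_eq_of_stageDrop_le hD (Finset.mem_range.mp hr) i, neg_smul]
      have h2 := h.sqNorm_step_le_drop (t + 1) r
      rw [e, sqNorm_smul] at h2
      rw [div_mul_eq_mul_div, le_div_iff₀ hα]
      refine le_of_mul_le_mul_left ?_ hα
      linarith
    have h2 := h.consErr_x_le_drop (t + 1) r
    have h3 := h.consErr_y_le_drop (t + 1) r
    have h4 : 2 / A.a ≤ 2 / A.a / A.α (t + 1) :=
      le_div_self (by positivity) hα (A.α_le_one _)
    have h5 := mul_le_mul_of_nonneg_right h4 hd0
    have e : gapConst N A.a / A.α (t + 1)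
        = 4 * N / A.α (t + 1) + 2 / A.a / A.α (t + 1) + N / A.α (t + 1) := by
      unfold gapConst
      ring
    rw [e]
    linarith
  have hsum := Finset.sum_le_sum hterm
  rw [← Finset.mul_sum] at hsum
  have h1 := h.one_le_R_mul (t + 1)
  have hg := gapConst_pos h.hN ha
  have hD0 := h.stageDrop_nonneg (t + 1)
  rw [avgGap, one_div_mul_eq_div, div_le_iff₀ hR]
  refine hsum.trans ?_
  change gapConst N A.a / A.α (t + 1) * A.stageDrop (t + 1) ≤ _
  rw [div_mul_eq_mul_div, div_le_iff₀ hα]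
  have := mul_le_mul_of_nonneg_left h1 (mul_nonneg hg.le hD0)
  linarith

theorem exists_avgGap_le {T : ℕ} (hT : 0 < T)
    (hT' : 128 * (A.P (A.state 1) 1 - flow) ≤ T * (A.acc * d ^ 2)) :
    ∃ t, 1 ≤ t ∧ t ≤ T ∧
      A.avgGap t ≤ gapConst N A.a * (A.P (A.state 1) 1 - flow) * A.acc := by
  obtain ⟨t, htT, ht⟩ := h.exists_stageDrop_le hT
  have hT1 : (1 : ℝ) ≤ T := by exact_mod_cast hT
  have hD0 := h.stageDrop_nonneg (t + 1)
  have hD : A.stageDrop (t + 1) ≤ A.acc * d ^ 2 / 128 := by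
    have : T * A.stageDrop (t + 1) ≤ T * (A.acc * d ^ 2 / 128) := by linarith
    exact le_of_mul_le_mul_left this (by linarith)
  refine ⟨t + 1, by omega, by omega, (h.avgGap_le_of_stageDrop_le hD).trans ?_⟩
  have hg := gapConst_pos h.hN h.a_pos
  have hacc := h.acc_pos
  -- The factor 1/T is given away, since T ≥ 1.
  have : A.stageDrop (t + 1) ≤ A.P (A.state 1) 1 - flow := by nlinarith
  gcongr

/-! ### The cost -/

/-- Because L̂ ≥ 1, the reciprocal of each of the three terms in the minimum is at most a constant
times L̂², and `stepConst` adds up the constants. -/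
theorem inv_α_le (t : ℕ) : 1 ≤ stepConst N A.γ A.ξ A.a A.b * A.Lh t ^ 2 * A.α t := by
  have hγ := h.γ_pos
  have hξ := h.ξ_pos
  have ha := h.a_pos
  have hb := h.b_pos
  have hℓ := h.one_le_Lh t
  have hN : (0 : ℝ) < N := by exact_mod_cast h.hN
  have hC := stepConst_pos (N := N) hγ hξ ha hb
  have hℓ2 : A.Lh t ≤ A.Lh t ^ 2 := by nlinarith
  have p1 : 0 ≤ 8 * N * (1 / (2 * N) + (1 / A.γ + 5 / 4)) := by positivity
  have p2 : 0 ≤ 64 * (1 + 1 / A.ξ) / (N * A.a * A.b) := by positivity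
  set ℓ := A.Lh t with hℓdef
  set C := stepConst N A.γ A.ξ A.a A.b with hCdef
  have hC1 : 8 * N * (1 / (2 * N) + (1 / A.γ + 5 / 4)) ≤ C := by
    rw [hCdef, stepConst]; linarith
  have hC2 : 64 * (1 + 1 / A.ξ) / (N * A.a * A.b) ≤ C := by rw [hCdef, stepConst]; linarith
  have hC3 : 1 ≤ C := by rw [hCdef, stepConst]; linarith
  have key : 1 / (C * ℓ ^ 2) ≤ A.α t := by
    refine le_min (le_min ?_ ?_) ?_
    · rw [one_div_mul_one_div, ← hℓdef]
      refine one_div_le_one_div_of_le (by positivity) ?_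
      calc 8 * N * (ℓ / (2 * N) + (1 / A.γ + 5 / 4))
          ≤ 8 * N * (ℓ * (1 / (2 * N)) + ℓ * (1 / A.γ + 5 / 4)) := by
            gcongr
            · exact le_of_eq (by ring)
            · exact le_mul_of_one_le_left (by positivity) hℓ
        _ = 8 * N * (1 / (2 * N) + (1 / A.γ + 5 / 4)) * ℓ := by ring
        _ ≤ C * ℓ ^ 2 := by gcongr
    · rw [← hℓdef, div_le_div_iff₀ (by positivity) (by positivity), one_mul]
      rw [div_le_iff₀ (by positivity)] at hC2
      nlinarith [mul_le_mul_of_nonneg_right hC2 (sq_nonneg ℓ)]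
    · rw [div_le_one (by positivity)]
      nlinarith
  rwa [div_le_iff₀ (by positivity), mul_comm] at key

omit h in
theorem comm_iter (A : Input N K) (t r : ℕ) : (A.iter t r).comm = (A.state t).comm + r := by
  induction r with
  | zero => rfl
  | succ r ih => rw [iter_succ, innerStep]; simp only; rw [ih]; rfl

omit h in
theorem grads_iter (A : Input N K) (t r : ℕ) :
    (A.iter t r).grads = (A.state t).grads + 2 * r := by
  induction r with
  | zero => rfl
  | succ r ih => rw [iter_succ, innerStep]; simp only; rw [ih]; ring

omit h in
theorem comm_state (A : Input N K) (t : ℕ) :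
    (A.state t).comm = ∑ k ∈ Finset.range t, A.R k := by
  induction t with
  | zero => rfl
  | succ t ih => rw [← iter_R, comm_iter, ih, Finset.sum_range_succ]

omit h in
theorem grads_state (A : Input N K) (t : ℕ) :
    (A.state t).grads = 1 + 2 * ∑ k ∈ Finset.range t, A.R k := by
  induction t with
  | zero => rfl
  | succ t ih => rw [← iter_R, grads_iter, ih, Finset.sum_range_succ]; ring

theorem sum_R_le {T : ℕ} (hT : 0 < T) :
    ((∑ k ∈ Finset.range (T + 1), A.R k : ℕ) : ℝ)
      ≤ 12 / 5 * stepConst N A.γ A.ξ A.a A.b * (T * (1 / A.acc) * A.Lh T ^ 2) := by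
  have hacc := h.acc_pos
  set C := stepConst N A.γ A.ξ A.a A.b with hCdef
  have hC : 0 < C := stepConst_pos h.γ_pos h.ξ_pos h.a_pos h.b_pos
  have hR : ∀ k ∈ Finset.range (T + 1), (A.R k : ℝ) ≤ 6 / 5 * C * A.Lh T ^ 2 * (1 / A.acc) := by
    intro k hk
    have hk' : k ≤ T := by simpa [Nat.lt_succ_iff] using hk
    have hα := h.α_pos k
    have h1 := h.R_mul_le k
    have h2 := h.inv_α_le k
    have h3 : A.Lh k ^ 2 ≤ A.Lh T ^ 2 :=
      pow_le_pow_left₀ (by linarith [h.one_le_Lh k]) (h.Lh_mono hk') 2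
    rw [mul_one_div, le_div_iff₀ hacc]
    refine le_of_mul_le_mul_right ?_ hα
    calc A.R k * A.acc * A.α k ≤ 6 / 5 * 1 := by linarith
      _ ≤ 6 / 5 * (C * A.Lh k ^ 2 * A.α k) := by gcongr
      _ ≤ 6 / 5 * (C * A.Lh T ^ 2 * A.α k) := by gcongr
      _ = _ := by ring
  push_cast
  refine (Finset.sum_le_sum hR).trans ?_
  rw [Finset.sum_const, Finset.card_range, nsmul_eq_mul]
  have hT1 : (1 : ℝ) ≤ T := by exact_mod_cast hT
  -- Stage 0 makes T + 1 stages; doubling T pays for it.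
  have h5 : ((T + 1 : ℕ) : ℝ) ≤ 2 * T := by push_cast; linarith
  have h6 : 0 ≤ 6 / 5 * C * A.Lh T ^ 2 * (1 / A.acc) := by positivity
  refine (mul_le_mul_of_nonneg_right h5 h6).trans_eq ?_
  ring

theorem cost_le {T : ℕ} (hT : 0 < T) :
    ((A.state (T + 1)).comm : ℝ)
        ≤ (5 * stepConst N A.γ A.ξ A.a A.b + 2) * (T * (1 / A.acc) * A.Lh T ^ 2) ∧
      ((A.state (T + 1)).grads : ℝ)
        ≤ (5 * stepConst N A.γ A.ξ A.a A.b + 2) * (T * (1 / A.acc) * A.Lh T ^ 2) := by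
  have hacc := h.acc_pos
  have hC : 0 < stepConst N A.γ A.ξ A.a A.b := stepConst_pos h.γ_pos h.ξ_pos h.a_pos h.b_pos
  have h1 := h.sum_R_le hT
  have hT1 : (1 : ℝ) ≤ T := by exact_mod_cast hT
  have h2 : 1 / 2 ≤ 1 / A.acc :=
    one_div_le_one_div_of_le hacc (by linarith [h.acc_lt, h.a_le_one])
  have h3 : 1 ≤ A.Lh T ^ 2 := one_le_pow₀ (h.one_le_Lh T)
  -- Twice this quantity pays for the one initial gradient evaluation.
  have h4 : 1 / 2 ≤ T * (1 / A.acc) * A.Lh T ^ 2 := by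
    calc (1 : ℝ) / 2 = 1 * (1 / 2) * 1 := by ring
      _ ≤ _ := by gcongr
  set B := T * (1 / A.acc) * A.Lh T ^ 2
  have h5 := mul_nonneg hC.le (by linarith : 0 ≤ B)
  rw [comm_state, grads_state]
  constructor
  · linarith
  · rw [Nat.cast_add, Nat.cast_mul]
    norm_num at *
    linarith

/-! ### The potential at the beginning of the first stage -/

/-- Halving the distances to z brings the squared consensus error down to at most 1/4, while the
weighted tracking error grows by at most (a/32)(8 + 1/2) ≤ 17/64 of it, and 1/4 + 17/64 ≤ 1. The
weight is that of stage 1 because the iterates lie in X(1). -/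
theorem stage_zero_noninc (r : ℕ) :
    consErr (A.iter 0 (r + 1)).x + A.wt 1 * consErr (A.iter 0 (r + 1)).y
      ≤ consErr (A.iter 0 r).x + A.wt 1 * consErr (A.iter 0 r).y := by
  have hmem := h.iter_mem (A.convex_X 1) (h.X_mono zero_le_one) h.state_zero_mem
  have hx : (A.iter 0 (r + 1)).x
      = mix A.W fun i => (1 / 2 : ℝ) • ((A.iter 0 r).x i - mean A.x0) + mean A.x0 := by
    rw [iter_succ, innerStep_x]
    have := h.step_zero r
    rw [step] at this
    rw [this]
    congr 1
    funext i
    module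
  have hdir : sqNorm (dir (A.X 0) (A.α 0) (A.iter 0 r)) = consErr (A.iter 0 r).x := by
    have := h.step_zero r
    rw [step] at this
    rw [this, consErr, h.mean_iter_zero]
    unfold sqNorm
    simp_rw [norm_sub_rev]
  have h1 : consErr (A.iter 0 (r + 1)).x ≤ 1 / 4 * consErr (A.iter 0 r).x := by
    rw [hx]
    refine (h.mixing.consErr_mix_le h.hN _).trans ?_
    have e := consErr_sub_const h.hN
      (fun i => (1 / 2 : ℝ) • ((A.iter 0 r).x i - mean A.x0)) (-mean A.x0)
    simp only [sub_neg_eq_add] at e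
    rw [e, consErr_smul, consErr_sub_const h.hN]
    have h2 : eta A.W ^ 2 ≤ 1 := by
      have := h.a_pos
      have := mul_nonneg h.γ_pos.le (sq_nonneg (eta A.W))
      unfold a at *
      linarith
    have h3 := consErr_nonneg (A.iter 0 r).x
    nlinarith
  have h2 := sqNorm_innerStep_sub_le (f := A.f) h.mixing (A.X 0) (A.α 0) (A.iter 0 r)
  have hmem' := hmem (r + 1)
  rw [iter_succ] at hmem'
  have h3 := consErr_tracker_le h.hN h.mixing h.problem (A.isCompact_X 1) h.ξ_pos (hmem r) hmem'
  rw [hdir] at h2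
  rw [← iter_succ] at h2 h3
  change _ ≤ _ + (1 + 1 / A.ξ) * A.Lh 1 ^ 2 * _ at h3
  have hξ := h.ξ_pos
  have hℓ := h.one_le_Lh 1
  have h4 := mul_le_mul_of_nonneg_left h2 (by positivity : 0 ≤ (1 + 1 / A.ξ) * A.Lh 1 ^ 2)
  have h5 := mul_le_mul_of_nonneg_left (h3.trans (add_le_add_right h4 _)) (h.wt_pos 1).le
  have h6 : A.wt 1 * ((1 + 1 / A.ξ) * A.Lh 1 ^ 2) = A.a / 32 := by
    unfold wt
    field_simp
  have h7 : A.wt 1 * (((1 + 1 / A.ξ) * A.Lh 1 ^ 2)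
      * (8 * consErr (A.iter 0 r).x + 1 / 2 * consErr (A.iter 0 r).x))
      ≤ 17 / 64 * consErr (A.iter 0 r).x := by
    rw [← mul_assoc, h6]
    have := mul_le_mul_of_nonneg_right h.a_le_one (consErr_nonneg (A.iter 0 r).x)
    linarith
  have h8 : A.wt 1 * ((1 + A.ξ) * eta A.W ^ 2 * consErr (A.iter 0 r).y)
      ≤ A.wt 1 * consErr (A.iter 0 r).y := by
    refine mul_le_mul_of_nonneg_left ?_ (h.wt_pos 1).le
    refine mul_le_of_le_one_left (consErr_nonneg _) ?_
    have := h.b_pos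
    unfold b at this
    linarith
  have h9 := consErr_nonneg (A.iter 0 r).x
  linarith

/-- The right side involves neither d nor the accuracy, which makes the constants of (2) uniform. -/
theorem P_state_one_le :
    A.P (A.state 1) 1 ≤ avgFun A.f (mean A.x0) + consErr A.x0
      + consErr fun i => gradient (A.f i) (A.x0 i) := by
  have h1 : ∀ r, consErr (A.iter 0 r).x + A.wt 1 * consErr (A.iter 0 r).y
      ≤ consErr A.x0 + A.wt 1 * consErr fun i => gradient (A.f i) (A.x0 i) := by
    intro r
    induction r with
    | zero => exact le_rfl
    | succ r ih => exact (h.stage_zero_noninc r).trans ih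
  have h2 := h1 (A.R 0)
  have h3 : A.wt 1 ≤ 1 := by
    have hξ : 0 < 1 / A.ξ := by have := h.ξ_pos; positivity
    have h4 : 1 ≤ A.Lh 1 ^ 2 := one_le_pow₀ (h.one_le_Lh 1)
    unfold wt
    rw [div_le_one (by positivity)]
    nlinarith [h.a_le_one]
  have h4 := mul_le_mul_of_nonneg_right h3
    (consErr_nonneg fun i => gradient (A.f i) (A.x0 i))
  rw [P_eq, ← iter_R, h.mean_iter_zero]
  linarith

end Input.Standing

/-! ### Growth of polynomials -/

/-- `g` grows, on balls about the origin, like a polynomial of degree `n`: its values are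
`O(ρ^n)` and its Lipschitz constants are `O(ρ^(n-1))`. -/
def PolyGrowth (n : ℕ) (g : Vec K → ℝ) : Prop :=
  ∃ C : ℝ, 0 ≤ C ∧ ∀ ρ : ℝ, 1 ≤ ρ → ∀ u : Vec K, ‖u‖ ≤ ρ →
    |g u| ≤ C * ρ ^ n ∧ ∀ w : Vec K, ‖w‖ ≤ ρ → ρ * |g u - g w| ≤ C * ρ ^ n * ‖u - w‖

namespace PolyGrowth

variable {n m : ℕ} {g k : Vec K → ℝ}

theorem const (c : ℝ) : PolyGrowth 0 fun _ : Vec K => c :=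
  ⟨|c|, abs_nonneg c, fun ρ _ u _ => ⟨by simp, fun w _ => by simp; positivity⟩⟩

theorem coord (j : Fin K) : PolyGrowth 1 fun u : Vec K => u j := by
  refine ⟨1, zero_le_one, fun ρ hρ u hu => ⟨?_, fun w _ => ?_⟩⟩
  · have := PiLp.norm_apply_le u j
    rw [Real.norm_eq_abs] at this
    linarith
  · have := PiLp.norm_apply_le (u - w) j
    rw [Real.norm_eq_abs, PiLp.sub_apply] at this
    have := mul_le_mul_of_nonneg_left this (by linarith : 0 ≤ ρ)
    linarith

theorem mono (hg : PolyGrowth n g) (h : n ≤ m) : PolyGrowth m g := by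
  obtain ⟨C, hC, H⟩ := hg
  refine ⟨C, hC, fun ρ hρ u hu => ?_⟩
  obtain ⟨h1, h2⟩ := H ρ hρ u hu
  have h3 : ρ ^ n ≤ ρ ^ m := pow_le_pow_right₀ hρ h
  exact ⟨h1.trans (by gcongr), fun w hw => (h2 w hw).trans (by gcongr)⟩

theorem add (hg : PolyGrowth n g) (hk : PolyGrowth n k) : PolyGrowth n fun u => g u + k u := by
  obtain ⟨C, hC, H⟩ := hg
  obtain ⟨D, hD, J⟩ := hk
  refine ⟨C + D, by positivity, fun ρ hρ u hu => ?_⟩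
  obtain ⟨h1, h2⟩ := H ρ hρ u hu
  obtain ⟨j1, j2⟩ := J ρ hρ u hu
  refine ⟨(abs_add_le _ _).trans (by linarith), fun w hw => ?_⟩
  have e : g u + k u - (g w + k w) = (g u - g w) + (k u - k w) := by ring
  rw [e]
  have h3 := mul_le_mul_of_nonneg_left (abs_add_le (g u - g w) (k u - k w))
    (by linarith : 0 ≤ ρ)
  linarith [h2 w hw, j2 w hw]

/-- Discrete Leibniz rule. With the factor ρ on the left of the Lipschitz clause, exponents simply
add and n - 1 never appears. -/
theorem mul (hg : PolyGrowth n g) (hk : PolyGrowth m k) :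
    PolyGrowth (n + m) fun u => g u * k u := by
  obtain ⟨C, hC, H⟩ := hg
  obtain ⟨D, hD, J⟩ := hk
  refine ⟨2 * (C * D), by positivity, fun ρ hρ u hu => ?_⟩
  have hρ0 : 0 < ρ := by linarith
  obtain ⟨h1, h2⟩ := H ρ hρ u hu
  obtain ⟨j1, j2⟩ := J ρ hρ u hu
  have hCD : 0 ≤ C * D * ρ ^ (n + m) := by positivity
  constructor
  · rw [abs_mul]
    have := mul_le_mul h1 j1 (abs_nonneg _) (by positivity)
    rw [pow_add] at hCD ⊢
    linarith
  · intro w hw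
    have j1w := (J ρ hρ w hw).1
    have e : g u * k u - g w * k w = g u * (k u - k w) + (g u - g w) * k w := by ring
    have t1 : ρ * |g u * (k u - k w)| ≤ C * ρ ^ n * (D * ρ ^ m * ‖u - w‖) := by
      rw [abs_mul, mul_left_comm]
      exact mul_le_mul h1 (j2 w hw) (by positivity) (by positivity)
    have t2 : ρ * |(g u - g w) * k w| ≤ C * ρ ^ n * ‖u - w‖ * (D * ρ ^ m) := by
      rw [abs_mul, ← mul_assoc]
      exact mul_le_mul (h2 w hw) j1w (abs_nonneg _) (by positivity)
    have t3 := mul_le_mul_of_nonneg_left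
      (abs_add_le (g u * (k u - k w)) ((g u - g w) * k w)) hρ0.le
    rw [e, pow_add]
    linarith

theorem pow (hg : PolyGrowth n g) (j : ℕ) : PolyGrowth (n * j) fun u => g u ^ j := by
  induction j with
  | zero => simpa using const 1
  | succ j ih => simpa only [pow_succ, Nat.mul_succ] using ih.mul hg

theorem prod {ι : Type*} (S : Finset ι) {e : ι → ℕ} {F : ι → Vec K → ℝ}
    (hF : ∀ i ∈ S, PolyGrowth (e i) (F i)) : PolyGrowth (∑ i ∈ S, e i) fun u => ∏ i ∈ S, F i u := by
  classical
  induction S using Finset.induction_on with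
  | empty => simpa using const 1
  | insert i S hi ih =>
    simp only [Finset.sum_insert hi, Finset.prod_insert hi]
    exact (hF i (Finset.mem_insert_self _ _)).mul
      (ih fun j hj => hF j (Finset.mem_insert_of_mem hj))

theorem sum {ι : Type*} (S : Finset ι) {F : ι → Vec K → ℝ}
    (hF : ∀ i ∈ S, PolyGrowth n (F i)) : PolyGrowth n fun u => ∑ i ∈ S, F i u := by
  classical
  induction S using Finset.induction_on with
  | empty => simpa using (const 0).mono (Nat.zero_le n)
  | insert i S hi ih =>
    simp only [Finset.sum_insert hi]
    exact (hF i (Finset.mem_insert_self _ _)).add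
      (ih fun j hj => hF j (Finset.mem_insert_of_mem hj))

theorem eval (p : MvPolynomial (Fin K) ℝ) (hp : p.totalDegree ≤ n) :
    PolyGrowth n fun u : Vec K => MvPolynomial.eval (fun k => u k) p := by
  simp only [MvPolynomial.eval_eq]
  refine sum _ fun s hs => ?_
  have h1 : PolyGrowth (∑ i ∈ s.support, s i)
      fun u : Vec K => ∏ i ∈ s.support, (u i) ^ s i :=
    prod _ fun i _ => by simpa using (coord i).pow (s i)
  have h2 := (const (p.coeff s)).mul h1
  rw [zero_add] at h2
  exact h2.mono ((MvPolynomial.le_totalDegree hs).trans hp)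

end PolyGrowth

theorem totalDegree_pderiv_le (j : Fin K) (p : MvPolynomial (Fin K) ℝ) {m : ℕ}
    (hp : p.totalDegree ≤ m + 1) : (MvPolynomial.pderiv j p).totalDegree ≤ m := by
  rw [p.as_sum, map_sum]
  refine MvPolynomial.totalDegree_finsetSum_le fun s hs => ?_
  rw [MvPolynomial.pderiv_monomial]
  -- If s j = 0, truncated subtraction does not lower the degree, but the coefficient vanishes.
  by_cases hj : s j = 0
  · simp [hj]
  · refine (MvPolynomial.totalDegree_monomial_le _ _).trans ?_
    have h1 := (MvPolynomial.le_totalDegree hs).trans hp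
    have h2 : (s - Finsupp.single j 1) + Finsupp.single j 1 = s :=
      tsub_add_cancel_of_le (by simpa [Finsupp.single_le_iff] using Nat.one_le_iff_ne_zero.mpr hj)
    have h3 : (s.sum fun _ e => e) = ((s - Finsupp.single j 1).sum fun _ e => e) + 1 := by
      conv_lhs => rw [← h2]
      rw [Finsupp.sum_add_index' (fun _ => rfl) (fun _ _ _ => rfl)]
      simp
    change (Finsupp.sum _ fun _ e => e) ≤ m
    omega

theorem hasFDerivAt_eval (p : MvPolynomial (Fin K) ℝ) (u : Vec K) :
    HasFDerivAt (fun u : Vec K => MvPolynomial.eval (fun k => u k) p)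
      (∑ j, MvPolynomial.eval (fun k => u k) (MvPolynomial.pderiv j p)
        • (EuclideanSpace.proj j : Vec K →L[ℝ] ℝ)) u := by
  induction p using MvPolynomial.induction_on with
  | C a =>
    simp only [MvPolynomial.eval_C, MvPolynomial.pderiv_C, map_zero, zero_smul,
      Finset.sum_const_zero]
    exact hasFDerivAt_const a u
  | add p q hp hq =>
    simp only [map_add, add_smul, Finset.sum_add_distrib]
    exact hp.add hq
  | mul_X p i hp =>
    have h1 : HasFDerivAt (fun u : Vec K => u i) (EuclideanSpace.proj i : Vec K →L[ℝ] ℝ) u :=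
      (EuclideanSpace.proj i : Vec K →L[ℝ] ℝ).hasFDerivAt
    have h2 := hp.mul h1
    simp only [MvPolynomial.eval_mul, MvPolynomial.eval_X]
    refine h2.congr_fderiv ?_
    ext w
    simp [MvPolynomial.pderiv_X, Pi.single_apply,
      apply_ite (MvPolynomial.eval fun k => u k), mul_add, Finset.sum_add_distrib, Finset.mul_sum,
      mul_comm, mul_left_comm]

theorem gradient_eval_apply (p : MvPolynomial (Fin K) ℝ) (u : Vec K) (j : Fin K) :
    gradient (fun u : Vec K => MvPolynomial.eval (fun k => u k) p) u j
      = MvPolynomial.eval (fun k => u k) (MvPolynomial.pderiv j p) := by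
  have h1 : gradient (fun u : Vec K => MvPolynomial.eval (fun k => u k) p) u
      = WithLp.toLp 2 fun j => MvPolynomial.eval (fun k => u k) (MvPolynomial.pderiv j p) := by
    apply HasGradientAt.gradient
    rw [hasGradientAt_iff_hasFDerivAt]
    refine (hasFDerivAt_eval p u).congr_fderiv ?_
    ext w
    simp [PiLp.inner_apply, mul_comm]
  rw [h1]

/-- The gradient of a polynomial of degree at most `m + 2` has Lipschitz constants `O(ρ^m)`. -/
theorem exists_lipOn_gradient_eval (p : MvPolynomial (Fin K) ℝ) {m : ℕ}
    (hp : p.totalDegree ≤ m + 2) :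
    ∃ C : ℝ, 0 ≤ C ∧ ∀ ρ : ℝ, 1 ≤ ρ →
      LipOn (gradient fun u : Vec K => MvPolynomial.eval (fun k => u k) p) (C * ρ ^ m)
        (Metric.closedBall 0 ρ) := by
  have h1 : ∀ j, PolyGrowth (m + 1)
      fun u : Vec K => MvPolynomial.eval (fun k => u k) (MvPolynomial.pderiv j p) := fun j =>
    PolyGrowth.eval _ (totalDegree_pderiv_le j p hp)
  choose C hC H using h1
  refine ⟨∑ j, C j, Finset.sum_nonneg fun j _ => hC j, fun ρ hρ u hu w hw => ?_⟩
  rw [mem_closedBall_zero_iff] at hu hw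
  have hρ0 : 0 < ρ := by linarith
  set g := gradient fun u : Vec K => MvPolynomial.eval (fun k => u k) p with hg
  have hj : ∀ j, |(g u - g w) j| ≤ C j * ρ ^ m * ‖u - w‖ := by
    intro j
    have h2 := (H j ρ hρ u hu).2 w hw
    rw [PiLp.sub_apply, hg, gradient_eval_apply, gradient_eval_apply]
    rw [pow_succ] at h2
    refine le_of_mul_le_mul_left ?_ hρ0
    linarith
  calc ‖g u - g w‖ ≤ ∑ j, |(g u - g w) j| := by
        rw [EuclideanSpace.norm_eq]
        refine Real.sqrt_le_left (Finset.sum_nonneg fun _ _ => abs_nonneg _) |>.mpr ?_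
        simp_rw [Real.norm_eq_abs]
        exact Finset.sum_sq_le_sq_sum_of_nonneg fun _ _ => abs_nonneg _
    _ ≤ ∑ j, C j * ρ ^ m * ‖u - w‖ := Finset.sum_le_sum fun j _ => hj j
    _ = (∑ j, C j) * ρ ^ m * ‖u - w‖ := by rw [Finset.sum_mul, Finset.sum_mul]

/-! ### Bounds for problem instances -/

theorem LipOn.mono {g : Vec K → Vec K} {ℓ ℓ' : ℝ} {X Y : Set (Vec K)} (hg : LipOn g ℓ Y)
    (hℓ : ℓ ≤ ℓ') (hXY : X ⊆ Y) : LipOn g ℓ' X := fun y hy z hz =>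
  (hg y (hXY hy) z (hXY hz)).trans (mul_le_mul_of_nonneg_right hℓ (norm_nonneg _))

theorem Input.ReachesWithin.mono {A : Input N K} {T : ℕ} {tol tol' B B' : ℝ}
    (h : A.ReachesWithin T tol B) (htol : tol ≤ tol') (hB : B ≤ B') :
    A.ReachesWithin T tol' B' := by
  obtain ⟨⟨t, h1, h2, h3⟩, h4, h5⟩ := h
  exact ⟨⟨t, h1, h2, h3.trans htol⟩, h4.trans hB, h5.trans hB⟩

theorem stages_pos {M d ε : ℝ} (hM : 0 < M) (hd : 0 < d) (hε : 0 < ε) : 0 < stages M d ε :=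
  Nat.ceil_pos.mpr (by positivity)

theorem le_stages_mul {M d ε : ℝ} (hd : 0 < d) (hε : 0 < ε) :
    M ≤ stages M d ε * (ε * d ^ 2) := by
  have h1 := Nat.le_ceil (M / (ε * d ^ 2))
  rwa [div_le_iff₀ (by positivity)] at h1

namespace Instance

variable {I : Instance N K} {G : SimpleGraph (Fin N)} {γ ξ d ε : ℝ}

/-- A bound of the initial potential gap `Δ` that does not depend on the radii and the accuracy. -/
def gapBound (I : Instance N K) : ℝ :=
  avgFun I.f (mean I.x0) + consErr I.x0 + consErr (fun i => gradient (I.f i) (I.x0 i)) - I.flow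

theorem standing_run (hN : 0 < N) (hγ : 0 < γ) (hξ : 0 < ξ) (hγη : (1 + γ) * eta I.W ^ 2 < 1)
    (hξη : (1 + ξ) * eta I.W ^ 2 < 1) (hW : MixingMatrix G I.W)
    (hp : ProblemAssumption I.f I.L I.Li I.flow) (hA : I.Admissible γ d ε) {κ : ℝ} (hκ : 0 < κ)
    (hκ1 : κ ≤ 1) : (I.run γ ξ d (κ * ε)).Standing G I.L I.flow d where
  hN := hN
  γ_pos := hγ
  ξ_pos := hξ
  a_pos := sub_pos.mpr hγη
  b_pos := sub_pos.mpr hξη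
  mixing := hW
  problem := hp
  d_pos := hA.1
  v_eq := fun _ => rfl
  acc_pos := mul_pos hκ hA.2.1
  acc_lt := (mul_le_of_le_one_left hA.2.1.le hκ1).trans_lt hA.2.2.1
  x0_mem := hA.2.2.2

theorem Δ_pos {acc : ℝ} (h : (I.run γ ξ d acc).Standing G I.L I.flow d) : 0 < I.Δ γ ξ d acc :=
  sub_pos.mpr (h.lt_P _ _)

theorem Δ_le_gapBound {acc : ℝ} (h : (I.run γ ξ d acc).Standing G I.L I.flow d) :
    I.Δ γ ξ d acc ≤ I.gapBound :=
  sub_le_sub_right h.P_state_one_le _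

theorem gapBound_pos (hp : ProblemAssumption I.f I.L I.Li I.flow) : 0 < I.gapBound := by
  have h1 := hp.lower (mean I.x0)
  have h2 := consErr_nonneg I.x0
  have h3 := consErr_nonneg (fun i => gradient (I.f i) (I.x0 i))
  unfold gapBound
  linarith

/-- Common source of (1), with acc = ε, and of (2), with acc = κε. -/
theorem reachesWithin_run {acc : ℝ} (h : (I.run γ ξ d acc).Standing G I.L I.flow d) {T : ℕ}
    (hT : 0 < T) (hT' : 128 * I.Δ γ ξ d acc ≤ T * (acc * d ^ 2)) :
    (I.run γ ξ d acc).ReachesWithin T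
      (gapConst N (1 - (1 + γ) * eta I.W ^ 2) * I.Δ γ ξ d acc * acc)
      ((5 * stepConst N γ ξ (1 - (1 + γ) * eta I.W ^ 2) (1 - (1 + ξ) * eta I.W ^ 2) + 2)
        * I.bound d acc T) := by
  have hC := stepConst_pos (N := N) h.γ_pos h.ξ_pos h.a_pos h.b_pos
  have hacc : 0 < acc := h.acc_pos
  have hgr : (I.run γ ξ d acc).Lh T ^ 2 ≤ gr I.L I.Li (mean I.x0) (d * (T : ℝ)) := by
    rw [mul_comm d]
    exact le_max_right _ _
  have hB : (5 * stepConst N γ ξ (1 - (1 + γ) * eta I.W ^ 2) (1 - (1 + ξ) * eta I.W ^ 2) + 2)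
      * (T * (1 / acc) * (I.run γ ξ d acc).Lh T ^ 2)
      ≤ (5 * stepConst N γ ξ (1 - (1 + γ) * eta I.W ^ 2) (1 - (1 + ξ) * eta I.W ^ 2) + 2)
        * I.bound d acc T := by
    refine mul_le_mul_of_nonneg_left ?_ ?_
    · exact mul_le_mul_of_nonneg_left hgr (by positivity)
    · have : 0 < stepConst N γ ξ (1 - (1 + γ) * eta I.W ^ 2) (1 - (1 + ξ) * eta I.W ^ 2) := hC
      linarith
  obtain ⟨h1, h2⟩ := h.cost_le hT
  exact ⟨h.exists_avgGap_le hT hT', h1.trans hB, h2.trans hB⟩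

theorem gr_nonneg (I : Instance N K) (v : ℝ) : 0 ≤ gr I.L I.Li (mean I.x0) v :=
  le_max_of_le_right (sq_nonneg _)

theorem bound_nonneg (hε : 0 < ε) (T : ℕ) : 0 ≤ I.bound d ε T :=
  mul_nonneg (by positivity) (I.gr_nonneg _)

theorem bound_mul {κ : ℝ} (T : ℕ) : I.bound d (κ * ε) T = 1 / κ * I.bound d ε T := by
  unfold bound
  rw [← one_div_mul_one_div]
  ring

/-- The growth function of a polynomial problem. -/
theorem exists_gr_le (hN : 0 < N) (hp : ProblemAssumption I.f I.L I.Li I.flow) {m : ℕ}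
    (hpoly : I.IsPoly (m + 2)) (hsharp : SharpConstants I.f I.Li) :
    ∃ C : ℝ, 1 ≤ C ∧ ∀ v : ℝ, 0 ≤ v →
      gr I.L I.Li (mean I.x0) v ≤ (C * (‖mean I.x0‖ + 1 + v) ^ m) ^ 2 := by
  choose p hpd hpe using hpoly
  choose C hC H using fun i => exists_lipOn_gradient_eval (p i) (hpd i)
  have hf : ∀ i, I.f i = fun u : Vec K => MvPolynomial.eval (fun k => u k) (p i) := fun i =>
    funext (hpe i)
  have hsum : 0 ≤ ∑ i, C i := Finset.sum_nonneg fun i _ => hC i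
  refine ⟨1 + ∑ i, C i, by linarith, fun v hv => ?_⟩
  -- The ball about z is put into one about the origin; the summand 1 ensures ρ ≥ 1.
  set ρ := ‖mean I.x0‖ + 1 + v with hρ
  have hρ1 : 1 ≤ ρ := by have := norm_nonneg (mean I.x0); linarith
  have hX := isCompact_closedBall (mean I.x0) v
  have hsub : Metric.closedBall (mean I.x0) v ⊆ Metric.closedBall 0 ρ :=
    Metric.closedBall_subset_closedBall' (by rw [dist_zero_right]; linarith)
  have hne : Nonempty (Fin N) := ⟨⟨0, hN⟩⟩
  have hle : Lhat I.Li (Metric.closedBall (mean I.x0) v) ≤ (1 + ∑ i, C i) * ρ ^ m := by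
    refine ciSup_le fun i => hsharp i _ hX _ ?_ ?_
    · exact one_le_mul_of_one_le_of_one_le (by linarith) (one_le_pow₀ hρ1)
    · rw [hf i]
      refine (H i ρ hρ1).mono ?_ hsub
      have : C i ≤ ∑ i, C i := Finset.single_le_sum (fun i _ => hC i) (Finset.mem_univ i)
      have h0 : 0 ≤ ρ ^ m := by positivity
      exact mul_le_mul_of_nonneg_right (by linarith) h0
  have h1 := hp.one_le_Lhat hN hX
  have h2 : Lhat I.Li (Metric.closedBall (mean I.x0) v) ^ 2 ≤ ((1 + ∑ i, C i) * ρ ^ m) ^ 2 :=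
    pow_le_pow_left₀ (by linarith) hle 2
  -- L ≤ L̂ ≤ L̂², as L̂ ≥ 1.
  refine max_le ((hp.L_le_Lhat _ hX).trans (le_trans ?_ h2)) h2
  nlinarith

theorem exists_bound_le (hN : 0 < N) (hp : ProblemAssumption I.f I.L I.Li I.flow) {m : ℕ}
    (hpoly : I.IsPoly (m + 2)) (hsharp : SharpConstants I.f I.Li) {S : ℝ} (hS : 0 < S) :
    ∃ C : ℝ, 0 < C ∧ ∀ ε : ℝ, 0 < ε → ε < 2 → ∀ T : ℕ, (T : ℝ) ≤ S →
      I.bound (1 / √ε) ε T ≤ C * (1 / ε ^ (m + 1)) := by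
  obtain ⟨C, hC, H⟩ := exists_gr_le hN hp hpoly hsharp
  -- As ε < 2 gives 2d ≥ 1, the fixed part ‖z‖ + 1 of the radius is also O(d), and the whole radius
  -- is at most Bd.
  set B := 2 * (‖mean I.x0‖ + 1) + S with hB
  have hB0 : 0 < B := by positivity
  refine ⟨S * (C * B ^ m) ^ 2, by positivity, fun ε hε hε2 T hT => ?_⟩
  set d := 1 / √ε with hd
  have hd0 : 0 < d := by positivity
  have hd2 : d ^ 2 = 1 / ε := by rw [hd, div_pow, Real.sq_sqrt hε.le, one_pow]
  have hd1 : 1 ≤ 2 * d := by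
    have : 1 / 2 < d ^ 2 := by rw [hd2]; exact one_div_lt_one_div_of_lt hε hε2
    nlinarith
  have hρ : ‖mean I.x0‖ + 1 + d * T ≤ B * d := by
    have h1 := mul_le_mul_of_nonneg_left hd1 (by positivity : 0 ≤ ‖mean I.x0‖ + 1)
    have h2 := mul_le_mul_of_nonneg_left hT hd0.le
    rw [hB]
    linarith
  have hgr : gr I.L I.Li (mean I.x0) (d * T) ≤ (C * B ^ m) ^ 2 * (1 / ε ^ m) := by
    calc gr I.L I.Li (mean I.x0) (d * T) ≤ (C * (‖mean I.x0‖ + 1 + d * T) ^ m) ^ 2 :=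
          H _ (by positivity)
      _ ≤ (C * (B * d) ^ m) ^ 2 := by gcongr
      _ = (C * B ^ m) ^ 2 * (d ^ 2) ^ m := by rw [mul_pow B d]; ring
      _ = _ := by rw [hd2, one_div_pow]
  calc I.bound d ε T = T * (1 / ε) * gr I.L I.Li (mean I.x0) (d * T) := rfl
    _ ≤ S * (1 / ε) * ((C * B ^ m) ^ 2 * (1 / ε ^ m)) :=
        mul_le_mul (mul_le_mul_of_nonneg_right hT (by positivity)) hgr (I.gr_nonneg _)
          (by positivity)
    _ = _ := by field_simp; ring

end Instance

theorem stages_le_of_eq_inv_sqrt {M ε : ℝ} (hM : 0 ≤ M) (hε : 0 < ε) :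
    (stages M (1 / √ε) ε : ℝ) ≤ M + 1 := by
  have e : ε * (1 / √ε) ^ 2 = 1 := by
    rw [div_pow, Real.sq_sqrt hε.le]
    field_simp
  rw [stages, e, div_one]
  exact (Nat.ceil_lt_add_one hM).le

end Magenta

end

/-! ### The main theorem -/

theorem corollary1 (N : ℕ) (hN : 0 < N) (η γ ξ : ℝ) (hγ : 0 < γ) (hξ : 0 < ξ)
    (hγη : (1 + γ) * η ^ 2 < 1) (hξη : (1 + ξ) * η ^ 2 < 1) :
    -- the constant `C₀` depends on `N`, `η`, `γ`, `ξ` only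
    ∃ C₀ : ℝ, 0 < C₀ ∧
    ∀ (K : ℕ) (I : Magenta.Instance N K) (G : SimpleGraph (Fin N)),
      Magenta.MixingMatrix G I.W → Magenta.eta I.W = η →
      Magenta.ProblemAssumption I.f I.L I.Li I.flow →
      -- accuracy parameter `ε` and explicit constant `128 (P(w⁰; 1) - flow)`: gap `O(ε)`
      (∀ d ε : ℝ, I.Admissible γ d ε →
        (I.run γ ξ d ε).ReachesWithin (Magenta.stages (128 * I.Δ γ ξ d ε) d ε)
          (C₀ * I.Δ γ ξ d ε * ε)
          (C₀ * I.bound d ε (Magenta.stages (128 * I.Δ γ ξ d ε) d ε))) ∧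
      -- accuracy parameter `κ ε`: gap at most `ε`; the constants do not depend on `d` and `ε`
      (∃ κ M C₁ : ℝ, 0 < κ ∧ 0 < M ∧ 0 < C₁ ∧
        (∀ d ε : ℝ, I.Admissible γ d ε →
          (I.run γ ξ d (κ * ε)).ReachesWithin (Magenta.stages M d ε) ε
            (C₁ * I.bound d ε (Magenta.stages M d ε))) ∧
        -- polynomials of degree at most `Q`, with `d = 1 / √ε`
        (∀ Q : ℕ, 2 ≤ Q → I.IsPoly Q → Magenta.SharpConstants I.f I.Li →
          ∃ C₂ : ℝ, 0 < C₂ ∧ ∀ d ε : ℝ, d = 1 / √ε → I.Admissible γ d ε →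
            I.bound d ε (Magenta.stages (128 * I.Δ γ ξ d ε) d ε) ≤ C₂ * (1 / ε ^ (Q - 1)) ∧
            I.bound d ε (Magenta.stages M d ε) ≤ C₂ * (1 / ε ^ (Q - 1)) ∧
            (I.run γ ξ d ε).ReachesWithin (Magenta.stages (128 * I.Δ γ ξ d ε) d ε)
              (C₂ * ε) (C₂ * (1 / ε ^ (Q - 1))) ∧
            (I.run γ ξ d (κ * ε)).ReachesWithin (Magenta.stages M d ε)
              ε (C₂ * (1 / ε ^ (Q - 1))))) := by
  have ha : 0 < 1 - (1 + γ) * η ^ 2 := sub_pos.mpr hγη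
  have hb : 0 < 1 - (1 + ξ) * η ^ 2 := sub_pos.mpr hξη
  set Cg := Magenta.gapConst N (1 - (1 + γ) * η ^ 2) with hCg
  set Cs := 5 * Magenta.stepConst N γ ξ (1 - (1 + γ) * η ^ 2) (1 - (1 + ξ) * η ^ 2) + 2 with hCs
  have hCg0 : 0 < Cg := Magenta.gapConst_pos hN ha
  have hCs0 : 0 < Cs := by
    have := Magenta.stepConst_pos (N := N) hγ hξ ha hb
    positivity
  refine ⟨Cg + Cs, by positivity, fun K I G hW hη hp => ?_⟩
  subst hη
  have hstand : ∀ κ : ℝ, 0 < κ → κ ≤ 1 → ∀ d ε : ℝ, I.Admissible γ d ε →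
      (I.run γ ξ d (κ * ε)).Standing G I.L I.flow d := fun κ hκ hκ1 d ε hA =>
    Magenta.Instance.standing_run hN hγ hξ hγη hξη hW hp hA hκ hκ1
  have hstand1 : ∀ d ε : ℝ, I.Admissible γ d ε → (I.run γ ξ d ε).Standing G I.L I.flow d :=
    fun d ε hA => by simpa using hstand 1 one_pos le_rfl d ε hA
  have part1 : ∀ d ε : ℝ, I.Admissible γ d ε →
      (I.run γ ξ d ε).ReachesWithin (Magenta.stages (128 * I.Δ γ ξ d ε) d ε)
        ((Cg + Cs) * I.Δ γ ξ d ε * ε)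
        ((Cg + Cs) * I.bound d ε (Magenta.stages (128 * I.Δ γ ξ d ε) d ε)) := by
    intro d ε hA
    have h := hstand1 d ε hA
    have hd := hA.1
    have hε := hA.2.1
    have hΔ := Magenta.Instance.Δ_pos h
    refine (Magenta.Instance.reachesWithin_run h
      (Magenta.stages_pos (by positivity) hd hε) (Magenta.le_stages_mul hd hε)).mono ?_ ?_
    · have : Cg ≤ Cg + Cs := by linarith
      gcongr
    · exact mul_le_mul_of_nonneg_right (by linarith) (Magenta.Instance.bound_nonneg hε _)
  set D := I.gapBound with hD
  have hD0 : 0 < D := Magenta.Instance.gapBound_pos hp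
  -- Chosen so that the gap bound Cg·Δ·κε is at most ε, and κ ≤ 1 keeps κε admissible as accuracy.
  set κ := 1 / (1 + Cg * D) with hκ
  have hκ0 : 0 < κ := by positivity
  have hκ1 : κ ≤ 1 := by
    rw [hκ, div_le_one (by positivity)]
    have := mul_pos hCg0 hD0
    linarith
  have hκD : Cg * D * κ ≤ 1 := by
    rw [hκ, mul_one_div, div_le_one (by positivity)]
    linarith
  -- With this M the stage count satisfies 128Δ ≤ T·κε·d² for every admissible d and ε.
  set M := 128 * D / κ with hM
  have hM0 : 0 < M := by positivity
  have part2 : ∀ d ε : ℝ, I.Admissible γ d ε →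
      (I.run γ ξ d (κ * ε)).ReachesWithin (Magenta.stages M d ε) ε
        (Cs / κ * I.bound d ε (Magenta.stages M d ε)) := by
    intro d ε hA
    have h := hstand κ hκ0 hκ1 d ε hA
    have hd := hA.1
    have hε := hA.2.1
    have hΔ := Magenta.Instance.Δ_le_gapBound h
    have hT : 128 * I.Δ γ ξ d (κ * ε) ≤ Magenta.stages M d ε * (κ * ε * d ^ 2) := by
      have h1 := mul_le_mul_of_nonneg_right (Magenta.le_stages_mul (M := M) hd hε) hκ0.le
      have h2 : M * κ = 128 * D := div_mul_cancel₀ _ hκ0.ne'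
      linarith
    refine (Magenta.Instance.reachesWithin_run h (Magenta.stages_pos hM0 hd hε) hT).mono ?_ ?_
    · calc Cg * I.Δ γ ξ d (κ * ε) * (κ * ε) ≤ Cg * D * (κ * ε) := by gcongr
        _ = Cg * D * κ * ε := by ring
        _ ≤ 1 * ε := by gcongr
        _ = ε := one_mul ε
    · rw [Magenta.Instance.bound_mul]
      exact le_of_eq (by ring)
  refine ⟨part1, κ, M, Cs / κ, hκ0, hM0, by positivity, part2, fun Q hQ hpoly hsharp => ?_⟩
  obtain ⟨m, rfl⟩ : ∃ m, Q = m + 2 := ⟨Q - 2, by omega⟩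
  -- As εd² = 1, both stage counts are at most S.
  obtain ⟨C, hC, H⟩ := Magenta.Instance.exists_bound_le hN hp hpoly hsharp
    (S := 128 * D + M + 1) (by positivity)
  refine ⟨C + (Cg + Cs) * C + Cs / κ * C + (Cg + Cs) * D, by positivity, ?_⟩
  rintro d ε rfl hA
  have h := hstand1 _ ε hA
  have hε := hA.2.1
  have hε2 : ε < 2 := by
    have h1 : 0 ≤ (1 + γ) * Magenta.eta I.W ^ 2 := by positivity
    linarith [hA.2.2.1]
  have hΔ0 := Magenta.Instance.Δ_pos h
  have hΔ := Magenta.Instance.Δ_le_gapBound h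
  have b1 := H ε hε hε2 (Magenta.stages (128 * I.Δ γ ξ (1 / √ε) ε) (1 / √ε) ε)
    ((Magenta.stages_le_of_eq_inv_sqrt (by positivity) hε).trans (by linarith))
  have b2 := H ε hε hε2 (Magenta.stages M (1 / √ε) ε)
    ((Magenta.stages_le_of_eq_inv_sqrt hM0.le hε).trans (by linarith))
  have e : m + 2 - 1 = m + 1 := rfl
  rw [e]
  set u := 1 / ε ^ (m + 1) with hu
  have hu0 : 0 < u := by positivity
  have c1 : 0 ≤ (Cg + Cs) * C := by positivity
  have c2 : 0 ≤ Cs / κ * C := by positivity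
  have c3 : 0 ≤ (Cg + Cs) * D := by positivity
  refine ⟨b1.trans ?_, b2.trans ?_, (part1 _ ε hA).mono ?_ ?_, (part2 _ ε hA).mono le_rfl ?_⟩
  · exact mul_le_mul_of_nonneg_right (by linarith) hu0.le
  · exact mul_le_mul_of_nonneg_right (by linarith) hu0.le
  · refine mul_le_mul_of_nonneg_right ?_ hε.le
    have := mul_le_mul_of_nonneg_left hΔ (by positivity : 0 ≤ Cg + Cs)
    linarith
  · refine (mul_le_mul_of_nonneg_left b1 (by positivity)).trans ?_
    rw [← mul_assoc]
    exact mul_le_mul_of_nonneg_right (by linarith) hu0.le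
  · refine (mul_le_mul_of_nonneg_left b2 (by positivity)).trans ?_
    rw [← mul_assoc]
    exact mul_le_mul_of_nonneg_right (by linarith) hu0.le
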